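/- All commutative topological groups below are complete and Hausdorff; countable means finite or countably infinite, and a sum over a countable index set means an unconditionally convergent sum (convergence of the net of finite partial sums). Definitions. A family $\mathfrak S$ of subsets of a set $X$ is an \emph{interval system} if for all $A,B\in\mathfrak S$ each of $A\setminus B$ and $A\cap B$ is the union of a countable family of pairwise disjoint members of $\mathfrak S$. A \emph{decomposition} of $A$ in $\mathfrak S$ is a countable indexed family $(A_\lambda)_{\lambda\in\Lambda}$ of pairwise disjoint members of $\mathfrak S$ with union $A$. For a commutative topological group $\mathcal W$, a function $\mu:\mathfrak S\to\mathcal W$ on an interval system is a \emph{measure} if $\mu(A)=\sum_{\lambda\in\Lambda}\mu(A_\lambda)$ for every $A\in\mathfrak S$ and every decomposition $(A_\lambda)_{\lambda\in\Lambda}$ of $A$ in $\mathfrak S$. For $\mathcal C\subset\mathcal V\times X$, $x\in X$ and $D\subset X$ let $\mathcal C^x=\{v:(v,x)\in\mathcal C\}$ and $\mathcal C^D=\bigcap_{x\in D}\mathcal C^x$. A \emph{pointed envelope} in $\mathcal V$ with respect to $\mathfrak S$ is a set $\mathcal C\subset\mathcal V\times X$ with $0\in\mathcal C^x$ for all $x\in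 X$, for which there is a countable $\mathfrak D\subset\mathfrak S$ such that \[\mathcal C=\Bigl(\bigcup_{D\in\mathfrak D}\mathcal C^D\times D\Bigr)\cup\Bigl(\{0\}\times\bigl(X\setminus\bigcup\mathfrak D\bigr)\Bigr).\] For a measure $\mu:\mathfrak S\to\mathcal W$ and a biadditive $L:\mathcal V\times\mathcal W\to\mathcal Z$ let $\int^{\mathrm p}L(\mathcal C,\mu)\subset\mathcal Z$ be the closure of the set of all finite sums $\sum_{j\in J}L(c_j,\mu(E_j))$ with $c_j\in\mathcal V$, $E_j\in\mathfrak S$, such that $\sum_{j\in J}c_j\chi_{E_j}(x)\in\mathcal C^x$ for all $x\in X$. The measure $\mu$ is of \emph{$\sigma$-locally finite semivariation} with respect to $L$ if for every $A\in\mathfrak S$ and every neighborhood $\mathcal T$ of $0$ in $\mathcal Z$ there is a pointed envelope $\mathcal C$ in $\mathcal V$ with respect to $\mathfrak S$ such that $\int^{\mathrm p}L(\mathcal C,\mu)\subset\mathcal T$ and $0$ is an interior point of $\mathcal C^x$ for every $x\in A$. For a $\mathcal V$-valued measure $\nu$, being of $\sigma$-locally finite semivariation with respect to $L$ means this condition for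 $\nu$ and the transposed pairing $(w,v)\mapsto L(v,w)$. Statement. Let $\mathfrak R$ and $\mathfrak S$ be interval systems on sets $Y$ and $X$, let $\mathcal V,\mathcal W,\mathcal Z$ be commutative topological groups, let $\nu:\mathfrak R\to\mathcal V$ and $\mu:\mathfrak S\to\mathcal W$ be measures, and let $L:\mathcal V\times\mathcal W\to\mathcal Z$ be a biadditive pairing which is separately continuous in both variables. Suppose that $\nu$ and $\mu$ are both of $\sigma$-locally finite semivariation with respect to $L$. Let $\mathfrak R\boxtimes_{L,\nu,\mu}\mathfrak S$ be the family of all sets $B\times A$ with $B\in\mathfrak R$, $A\in\mathfrak S$ such that for every decomposition $(B_\gamma)_{\gamma\in\Gamma}$ of $B$ in $\mathfrak R$ and every decomposition $(A_\lambda)_{\lambda\in\Lambda}$ of $A$ in $\mathfrak S$ the sum $\sum_{(\gamma,\lambda)\in\Gamma\times\Lambda}L(\nu(B_\gamma),\mu(A_\lambda))$ exists. Then $\mathfrak R\boxtimes_{L,\nu,\mu}\mathfrak S$ is an interval system, and \[B\times A\;\mapsto\;L(\nu(B),\mu(A))\] is a well-defined $\mathcal Z$-valued measure on it. -/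

import Mathlib

open Set Topology

namespace IntervalIntegration

/-- A family of sets is an interval system if for all members `A`, `B` the sets `A \ B` and `A ∩ B`
are unions of countable families of pairwise disjoint members. -/
def IsIntervalSystem {X : Type*} (S : Set (Set X)) : Prop :=
  ∀ A ∈ S, ∀ B ∈ S,
    (∃ C : Set (Set X), C ⊆ S ∧ C.Countable ∧ C.PairwiseDisjoint id ∧ ⋃₀ C = A \ B) ∧
    (∃ D : Set (Set X), D ⊆ S ∧ D.Countable ∧ D.PairwiseDisjoint id ∧ ⋃₀ D = A ∩ B)

/-- The indexed family `P` is a disjoint decomposition of `A` into members of `S`. -/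
structure IsDecomposition {X ι : Type*} (S : Set (Set X)) (A : Set X) (P : ι → Set X) : Prop where
  mem : ∀ i, P i ∈ S
  disjoint : Pairwise fun i j => Disjoint (P i) (P j)
  iUnion_eq : ⋃ i, P i = A

/-- `μ` is `σ`-additive on `S`: for every countable disjoint decomposition of a member of `S` into
members of `S`, the values sum up unconditionally. Only the values of `μ` on `S` matter. -/
def IsMeasureOn {X W : Type*} [AddCommGroup W] [TopologicalSpace W]
    (S : Set (Set X)) (μ : Set X → W) : Prop :=
  ∀ A ∈ S, ∀ (ι : Type) [Countable ι] (P : ι → Set X),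
    IsDecomposition S A P → HasSum (fun i => μ (P i)) (μ A)

/-- The function `∑ j, c j • χ_{E j}`. -/
noncomputable def stepFun {X V J : Type*} [AddCommGroup V] [Fintype J]
    (c : J → V) (E : J → Set X) (x : X) : V :=
  ∑ j, (E j).indicator (fun _ => c j) x

/-- The fibre `Z^x = {v | (v, x) ∈ Z}`. -/
def fibre {V X : Type*} (Z : Set (V × X)) (x : X) : Set V := {v | (v, x) ∈ Z}

/-- The set `Z^D = ⋂_{x ∈ D} Z^x`. -/
def commonFibre {V X : Type*} (Z : Set (V × X)) (D : Set X) : Set V := ⋂ x ∈ D, fibre Z x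

/-- The set `⟨𝔇⟩_Z`, the union of the `Z^D × D`, `D ∈ 𝔇`, and of `{0} × (X \ ⋃ 𝔇)`. -/
def generatedBy {V X : Type*} [AddCommGroup V] (Z : Set (V × X)) (𝔇 : Set (Set X)) :
    Set (V × X) :=
  (⋃ D ∈ 𝔇, commonFibre Z D ×ˢ D) ∪ ({0} ×ˢ (⋃₀ 𝔇)ᶜ)

/-- `C ⊆ V × X` is an envelope with respect to `S`: it contains the graph of some step-function,
and it is generated by a countable subfamily of `S`. -/
structure IsEnvelope {V X : Type*} [AddCommGroup V] (S : Set (Set X)) (C : Set (V × X)) :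
    Prop where
  exists_step : ∃ (J : Type) (_ : Fintype J) (c : J → V) (E : J → Set X),
    (∀ j, E j ∈ S) ∧ ∀ x, (stepFun c E x, x) ∈ C
  exists_generator : ∃ 𝔇 : Set (Set X), 𝔇 ⊆ S ∧ 𝔇.Countable ∧ C = generatedBy C 𝔇

/-- An envelope is pointed if it contains the graph of the zero function. -/
def IsPointed {V X : Type*} [AddCommGroup V] (C : Set (V × X)) : Prop :=
  ∀ x, ((0 : V), x) ∈ C

/-- The bilinear sum `∫ᵖ L(C, μ)`: the closure of the set of all sums `∑ j, L(c j, μ(E j))` where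
`E j ∈ S` and the graph of `∑ j, c j • χ_{E j}` is contained in `C`. -/
def bilinearSum {X V W Z : Type*} [AddCommGroup V] [AddCommGroup W] [AddCommGroup Z]
    [TopologicalSpace Z] (L : V →+ W →+ Z) (S : Set (Set X)) (μ : Set X → W) (C : Set (V × X)) :
    Set Z :=
  closure {z | ∃ (J : Type) (_ : Fintype J) (c : J → V) (E : J → Set X),
    (∀ j, E j ∈ S) ∧ (∀ x, (stepFun c E x, x) ∈ C) ∧ z = ∑ j, L (c j) (μ (E j))}

/-- `μ` is of `σ`-locally finite semivariation with respect to the pairing `L`. -/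
def IsSigmaLocallyFiniteSemivariation {X V W Z : Type*} [AddCommGroup V] [TopologicalSpace V]
    [AddCommGroup W] [AddCommGroup Z] [TopologicalSpace Z]
    (L : V →+ W →+ Z) (S : Set (Set X)) (μ : Set X → W) : Prop :=
  ∀ A ∈ S, ∀ T ∈ 𝓝 (0 : Z), ∃ C : Set (V × X),
    IsEnvelope S C ∧ IsPointed C ∧ bilinearSum L S μ C ⊆ T ∧
      ∀ x ∈ A, (0 : V) ∈ interior (fibre C x)

/-- The system `R ⊠_{L,ν,μ} S` of the products `B × A`, `B ∈ R`, `A ∈ S`, such that for every pair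
of countable disjoint decompositions of `B` in `R` and of `A` in `S` the double family
`L(ν(B_γ), μ(A_l))` is unconditionally summable. -/
def prodSystem {X Y V W Z : Type*} [AddCommGroup V] [AddCommGroup W] [AddCommGroup Z]
    [TopologicalSpace Z] (L : V →+ W →+ Z) (R : Set (Set Y)) (S : Set (Set X))
    (ν : Set Y → V) (μ : Set X → W) : Set (Set (Y × X)) :=
  {E | ∃ B ∈ R, ∃ A ∈ S, E = B ×ˢ A ∧
    ∀ (Γ Λ : Type) [Countable Γ] [Countable Λ] (P : Γ → Set Y) (Q : Λ → Set X),
      IsDecomposition R B P → IsDecomposition S A Q →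
        Summable fun p : Γ × Λ => L (ν (P p.1)) (μ (Q p.2))}

end IntervalIntegration

namespace IntervalIntegration

open Filter
open scoped Pointwise

/-! Let the rectangles `b i ×ˢ a i` partition `B ×ˢ A`. For each `x ∈ A` the `b i` with `x ∈ a i`
partition `B`, so the measures of the remainders of `B` tend to zero pointwise in `x`. The error of
a finite partial sum is the sum of `L (ν remainder) (μ atom)` over the atoms of the finitely many `a
i` involved, so the task is to make this convergence uniform on the pieces of one countable
decomposition of `A`.

Uniformity comes from a Baire argument. If countably many closed sets `K n` cover a neighbourhood of
`0`, then some single `K n - K n` contains almost all terms of a summable sequence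
(`eventually_mem_sub_of_summable`), hence its closure contains the measures of all sets far out in a
decomposition (`exists_tail_mem_closure_sub`). Finite semivariation supplies such `K n` for which
the resulting sums are small (`IsSmallCover`).

The pieces where uniformity sets in late are handled by a gliding hump: if the partial sums failed
to converge, disjoint finite blocks of large error would fit into one decomposition of `A` and
contradict summability (`hasSum_of_summable_refinement`). The summability needed there follows from
the grid condition by the same theorem with the factors exchanged (`summable_of_grid`), which is
where the semivariation of the other measure enters. All this is done on algebras of sets; interval
systems reduce to that case by extending the measures to countable disjoint unions. -/

/-! ### Subseries and Baire category -/

/-- Subsums depend continuously on the point of the Cantor space selecting the terms. By Baire, the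
preimage of some `K n` contains a cylinder; flipping a coordinate that the cylinder leaves free
changes the subsum by one term. -/
theorem eventually_mem_sub_of_summable {V : Type*} [AddCommGroup V] [UniformSpace V]
    [IsUniformAddGroup V] [CompleteSpace V] [T2Space V] {a : ℕ → V} (ha : Summable a)
    {O : Set V} (hO : O ∈ 𝓝 (0 : V)) {K : ℕ → Set V} (hK : ∀ n, IsClosed (K n))
    {I : Set ℕ} (hcov : O ⊆ ⋃ n ∈ I, K n) :
    ∃ n ∈ I, ∃ r₀, ∀ r ≥ r₀, a r ∈ K n - K n := by
  classical
  obtain ⟨s, hs⟩ := ha.tsum_vanishing hO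
  -- Omitting `s` keeps every subsum inside `O`, where the `K n` cover.
  let M : (ℕ → Bool) → Set ℕ := fun l => {r | l r = true ∧ r ∉ s}
  let Φ : (ℕ → Bool) → V := fun l => ∑' r, (M l).indicator a r
  have hsub : ∀ t : Set ℕ, Summable (t.indicator a) := fun t => ha.indicator t
  have hΦ : Continuous Φ := by
    rw [continuous_iff_continuousAt]
    intro l₀
    rw [ContinuousAt, ← tendsto_sub_nhds_zero_iff]
    intro e he
    obtain ⟨e', he', hee⟩ : ∃ e' ∈ 𝓝 (0 : V), ∀ v ∈ e', ∀ w ∈ e', v - w ∈ e := by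
      have : Tendsto (fun p : V × V => p.1 - p.2) (𝓝 ((0 : V), (0 : V))) (𝓝 0) := by
        simpa using (continuous_sub (G := V)).tendsto ((0 : V), (0 : V))
      have h2 := this he
      rw [nhds_prod_eq, mem_map, mem_prod_same_iff] at h2
      obtain ⟨t, ht, htt⟩ := h2
      exact ⟨t, ht, fun v hv w hw => htt (mk_mem_prod hv hw)⟩
    obtain ⟨u, hu⟩ := ha.tsum_vanishing he'
    have hopen : ∀ᶠ l in 𝓝 l₀, ∀ r ∈ u, l r = l₀ r := by
      rw [Filter.eventually_all_finset]
      intro r _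
      have : Tendsto (fun l : ℕ → Bool => l r) (𝓝 l₀) (𝓝 (l₀ r)) :=
        (continuous_apply r).tendsto l₀
      exact this.eventually (p := fun c => c = l₀ r) (by rw [nhds_discrete]; exact rfl)
    refine hopen.mono fun l hl => ?_
    have key : Φ l - Φ l₀ = (∑' r, (M l \ u).indicator a r) - ∑' r, (M l₀ \ u).indicator a r := by
      rw [← (hsub _).tsum_sub (hsub _), ← (hsub _).tsum_sub (hsub _)]
      refine tsum_congr fun r => ?_
      by_cases hr : r ∈ u
      · have : r ∈ M l ↔ r ∈ M l₀ := by simp [M, hl r hr]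
        by_cases h1 : r ∈ M l₀ <;> simp [indicator, hr, this, h1]
      · by_cases h1 : r ∈ M l <;> by_cases h2 : r ∈ M l₀ <;> simp [indicator, hr, h1, h2]
    change Φ l - Φ l₀ ∈ e
    rw [key, ← tsum_subtype, ← tsum_subtype]
    exact hee _ (hu _ disjoint_sdiff_left) _ (hu _ disjoint_sdiff_left)
  have hmem : ∀ l, Φ l ∈ O := fun l => by
    change ∑' r, (M l).indicator a r ∈ O
    rw [← tsum_subtype]
    exact hs _ (disjoint_left.2 fun r hr hr' => hr.2 hr')
  obtain ⟨⟨n, hn⟩, l₀, hl₀⟩ := nonempty_interior_of_iUnion_of_closed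
    (f := fun n : I => Φ ⁻¹' K n) (fun n => (hK n).preimage hΦ) (by
      refine eq_univ_of_forall fun l => ?_
      obtain ⟨n, hn, h⟩ := mem_iUnion₂.1 (hcov (hmem l))
      exact mem_iUnion.2 ⟨⟨n, hn⟩, h⟩)
  rw [mem_interior_iff_mem_nhds, nhds_pi, Filter.mem_pi] at hl₀
  obtain ⟨J, hJ, t, ht, hsubset⟩ := hl₀
  obtain ⟨r₀, hr₀⟩ := (hJ.union s.finite_toSet).bddAbove
  -- Beyond `r₀` a coordinate is neither constrained by the cylinder nor omitted by `M`.
  refine ⟨n, hn, r₀ + 1, fun r hr => ?_⟩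
  have hrJ : r ∉ J ∪ s := fun h => by have := hr₀ h; omega
  have hupd : ∀ c, Function.update l₀ r c ∈ Φ ⁻¹' K n := fun c => by
    refine hsubset fun j hj => ?_
    have : j ≠ r := fun h => hrJ (Or.inl (h ▸ hj))
    simpa [Function.update_of_ne this] using mem_of_mem_nhds (ht j)
  have hdiff : Φ (Function.update l₀ r true) - Φ (Function.update l₀ r false) = a r := by
    rw [← (hsub _).tsum_sub (hsub _), tsum_eq_single r]
    · have : r ∉ s := fun h => hrJ (Or.inr h)
      simp [M, indicator, this]
    · intro j hj
      simp [M, indicator, Function.update_of_ne hj]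
  rw [← hdiff]
  exact sub_mem_sub (hupd true) (hupd false)

/-! ### Algebras of sets and measures on them -/

/-- `𝒜` is an algebra of subsets of `A`. -/
structure IsAlgebraOn {X : Type*} (𝒜 : Set (Set X)) (A : Set X) : Prop where
  top_mem : A ∈ 𝒜
  subset : ∀ E ∈ 𝒜, E ⊆ A
  inter_mem : ∀ E ∈ 𝒜, ∀ F ∈ 𝒜, E ∩ F ∈ 𝒜
  diff_mem : ∀ E ∈ 𝒜, ∀ F ∈ 𝒜, E \ F ∈ 𝒜

namespace IsAlgebraOn

variable {X : Type*} {𝒜 : Set (Set X)} {A : Set X}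

theorem empty_mem (h : IsAlgebraOn 𝒜 A) : ∅ ∈ 𝒜 := by
  simpa using h.diff_mem A h.top_mem A h.top_mem

theorem union_mem (h : IsAlgebraOn 𝒜 A) {E F : Set X} (hE : E ∈ 𝒜) (hF : F ∈ 𝒜) :
    E ∪ F ∈ 𝒜 := by
  have : E ∪ F = A \ ((A \ E) \ F) := by
    have h1 := h.subset E hE
    have h2 := h.subset F hF
    ext x
    have := @h1 x
    have := @h2 x
    simp only [mem_union, Set.mem_sdiff]
    tauto
  rw [this]
  exact h.diff_mem _ h.top_mem _ (h.diff_mem _ (h.diff_mem _ h.top_mem _ hE) _ hF)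

theorem biUnion_mem (h : IsAlgebraOn 𝒜 A) {ι : Type*} (s : Finset ι) {E : ι → Set X}
    (hE : ∀ i ∈ s, E i ∈ 𝒜) : ⋃ i ∈ s, E i ∈ 𝒜 := by
  classical
  induction s using Finset.induction_on with
  | empty => simpa using h.empty_mem
  | insert i s _ ih =>
    rw [Finset.set_biUnion_insert]
    exact h.union_mem (hE i (by simp)) (ih fun j hj => hE j (by simp [hj]))

theorem inter_biInter_mem (h : IsAlgebraOn 𝒜 A) {ι : Type*} (s : Finset ι) {E : ι → Set X}
    (hE : ∀ i ∈ s, E i ∈ 𝒜) {F : Set X} (hF : F ∈ 𝒜) : F ∩ ⋂ i ∈ s, E i ∈ 𝒜 := by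
  classical
  induction s using Finset.induction_on with
  | empty => simpa using hF
  | insert i s _ ih =>
    rw [Finset.set_biInter_insert, inter_left_comm]
    exact h.inter_mem _ (hE i (by simp)) _ (ih fun j hj => hE j (by simp [hj]))

theorem exists_isDecomposition_subset (h : IsAlgebraOn 𝒜 A) {κ : Type} [Countable κ]
    {M : κ → Set X} (hM : ∀ p, M p ∈ 𝒜) (hcov : A ⊆ ⋃ p, M p) :
    ∃ H : κ → Set X, IsDecomposition 𝒜 A H ∧ ∀ p, H p ⊆ M p := by
  classical
  obtain ⟨e, he⟩ := exists_injective_nat κ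
  let s : κ → Finset κ := fun p => (Finset.range (e p)).preimage e he.injOn
  have hs : ∀ p q, q ∈ s p ↔ e q < e p := fun p q => by simp [s]
  refine ⟨fun p => M p \ ⋃ q ∈ s p, M q, ⟨fun p => ?_, fun p q hpq => ?_, ?_⟩,
    fun p => sdiff_subset⟩
  · exact h.diff_mem _ (hM p) _ (h.biUnion_mem _ fun q _ => hM q)
  · refine disjoint_left.2 ?_
    rintro x ⟨hxp, hxp'⟩ ⟨hxq, hxq'⟩
    simp only [mem_iUnion, hs, not_exists] at hxp' hxq'
    rcases lt_trichotomy (e p) (e q) with hlt | heq | hlt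
    · exact hxq' p hlt hxp
    · exact hpq (he heq)
    · exact hxp' q hlt hxq
  · refine Subset.antisymm (iUnion_subset fun p => sdiff_subset.trans (h.subset _ (hM p)))
      fun x hx => ?_
    have hex : ∃ n, ∃ p, e p = n ∧ x ∈ M p := by
      obtain ⟨p, hp⟩ := mem_iUnion.1 (hcov hx)
      exact ⟨e p, p, rfl, hp⟩
    obtain ⟨p, hpe, hp⟩ := Nat.find_spec hex
    refine mem_iUnion.2 ⟨p, hp, ?_⟩
    simp only [mem_iUnion, hs, not_exists]
    intro q hq hxq
    exact Nat.find_min hex (hpe ▸ hq) ⟨q, rfl, hxq⟩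

end IsAlgebraOn

namespace IsMeasureOn

variable {X W : Type*} [AddCommGroup W] [TopologicalSpace W] [T2Space W]
  {S : Set (Set X)} {μ : Set X → W}

theorem empty (h : IsMeasureOn S μ) (hS : ∅ ∈ S) : μ ∅ = 0 := by
  have := h ∅ hS Empty (fun i => i.elim) ⟨fun i => i.elim, fun i => i.elim, by simp⟩
  exact this.unique hasSum_empty

theorem biUnion_finset (h : IsMeasureOn S μ) {ι : Type} (s : Finset ι) {E : ι → Set X}
    (hE : ∀ i ∈ s, E i ∈ S) (hd : (s : Set ι).PairwiseDisjoint E) (hU : ⋃ i ∈ s, E i ∈ S) :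
    μ (⋃ i ∈ s, E i) = ∑ i ∈ s, μ (E i) := by
  have := h _ hU s (fun i => E i) ⟨fun i => hE i i.2, fun i j hij =>
    hd i.2 j.2 fun h => hij (Subtype.ext h), by ext; simp⟩
  rw [this.unique (hasSum_fintype _), Finset.sum_coe_sort s fun i => μ (E i)]

theorem diff (h : IsMeasureOn S μ) {E F : Set X} (hE : E ∈ S) (hF : F ∈ S) (hd : F \ E ∈ S)
    (hEF : E ⊆ F) : μ (F \ E) = μ F - μ E := by
  have := h F hF Bool (fun b => cond b E (F \ E)) ⟨?_, ?_, ?_⟩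
  · have h2 := this.unique (hasSum_fintype _)
    simp only [Fintype.sum_bool, cond_true, cond_false] at h2
    rw [h2]; abel
  · rintro (_ | _) <;> assumption
  · rintro (_ | _) (_ | _) hb
    · exact absurd rfl hb
    · exact disjoint_sdiff_left
    · exact disjoint_sdiff_right
    · exact absurd rfl hb
  · rw [← union_eq_iUnion, union_sdiff_cancel hEF]

end IsMeasureOn

/-! ### Uniform control of tails -/

/-- Otherwise every `n ∈ I` has bad sets arbitrarily far out. A disjoint sequence of them, in which
each `n` recurs infinitely often, extends to a decomposition of `B`; its values are summable,
against `eventually_mem_sub_of_summable`. -/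
theorem exists_tail_mem_closure_sub {Y V : Type*} [AddCommGroup V] [UniformSpace V]
    [IsUniformAddGroup V] [CompleteSpace V] [T2Space V] {𝓡 : Set (Set Y)} {B : Set Y}
    (h𝓡 : IsAlgebraOn 𝓡 B) {ν : Set Y → V} (hν : IsMeasureOn 𝓡 ν) {ι : Type}
    {e : ι → ℕ} (he : Function.Injective e) {P : ι → Set Y} (hP : IsDecomposition 𝓡 B P)
    {O : Set V} (hO : O ∈ 𝓝 (0 : V)) {K : ℕ → Set V} (hK : ∀ n, IsClosed (K n))
    {I : Set ℕ} (hcov : O ⊆ ⋃ n ∈ I, K n) :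
    ∃ n ∈ I, ∃ N, ∀ S ∈ 𝓡, (∀ i, e i < N → Disjoint S (P i)) → ν S ∈ closure (K n - K n) := by
  classical
  have : Countable ι := he.countable
  by_contra! hbad
  let s : ℕ → Finset ι := fun M => (Finset.range M).preimage e he.injOn
  have hs : ∀ M i, i ∈ s M ↔ e i < M := fun M i => by simp [s]
  have hs_tendsto : Tendsto s atTop atTop := by
    refine tendsto_atTop_finset_of_monotone (fun a b hab i hi => ?_) fun i => ⟨e i + 1, ?_⟩
    · rw [hs] at hi ⊢; omega
    · rw [hs]; omega
  -- Being bad is an open condition on `ν S`, so `S` can be replaced by its part in finitely many `P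
  -- i`.
  have hbad' : ∀ n ∈ I, ∀ N, ∃ S ∈ 𝓡, ∃ M, (∀ i, e i < N → Disjoint S (P i)) ∧
      (S ⊆ ⋃ i ∈ s M, P i) ∧ ν S ∉ closure (K n - K n) := by
    intro n hn N
    obtain ⟨S, hS, hSd, hνS⟩ := hbad n hn N
    have hsum : HasSum (fun i => ν (S ∩ P i)) (ν S) :=
      hν S hS ι _ ⟨fun i => h𝓡.inter_mem _ hS _ (hP.mem i),
        fun i j hij => (hP.disjoint hij).mono inter_subset_right inter_subset_right, by
        rw [← inter_iUnion, hP.iUnion_eq, inter_eq_left.2 (h𝓡.subset S hS)]⟩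
    have hev := (hsum.comp hs_tendsto).eventually (isClosed_closure.isOpen_compl.mem_nhds hνS)
    obtain ⟨M, hM⟩ := hev.exists
    have hUmem : ⋃ i ∈ s M, S ∩ P i ∈ 𝓡 :=
      h𝓡.biUnion_mem _ fun i _ => h𝓡.inter_mem _ hS _ (hP.mem i)
    refine ⟨⋃ i ∈ s M, S ∩ P i, hUmem, M, fun i hi => ?_, ?_, ?_⟩
    · exact (hSd i hi).mono_left (iUnion₂_subset fun i _ => inter_subset_left)
    · exact iUnion₂_mono fun i _ => inter_subset_right
    · rw [hν.biUnion_finset _ (fun i _ => h𝓡.inter_mem _ hS _ (hP.mem i)) _ hUmem]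
      · exact hM
      · exact fun i _ j _ hij => (hP.disjoint hij).mono inter_subset_right inter_subset_right
  -- Stage `r` treats `n = (Nat.unpair r).1`, so each `n` is treated infinitely often; stages with
  -- `n ∉ I` contribute `∅`.
  have hstep : ∀ r N : ℕ, ∃ S ∈ 𝓡, ∃ M, (∀ i, e i < N → Disjoint S (P i)) ∧
      (S ⊆ ⋃ i ∈ s M, P i) ∧ ((Nat.unpair r).1 ∈ I →
        ν S ∉ closure (K (Nat.unpair r).1 - K (Nat.unpair r).1)) := by
    intro r N
    by_cases hr : (Nat.unpair r).1 ∈ I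
    · obtain ⟨S, hS, M, h1, h2, h3⟩ := hbad' _ hr N
      exact ⟨S, hS, M, h1, h2, fun _ => h3⟩
    · exact ⟨∅, h𝓡.empty_mem, 0, by simp, by simp, fun h => absurd h hr⟩
  choose S hS M hSd hSM hSν using hstep
  let N : ℕ → ℕ := fun r => Nat.rec 0 (fun r N => max (N + 1) (M r N)) r
  have hN : ∀ r, N (r + 1) = max (N r + 1) (M r (N r)) := fun r => rfl
  have hNmono : StrictMono N := strictMono_nat_of_lt_succ fun r => by rw [hN]; omega
  let Q : ℕ → Set Y := fun r => S r (N r)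
  have hQ : ∀ r, Q r ∈ 𝓡 := fun r => hS _ _
  have hQP : ∀ r i, e i < N r → Disjoint (Q r) (P i) := fun r i hi => hSd _ _ i hi
  have hQN : ∀ r x, x ∈ Q r → ∃ i, e i < N (r + 1) ∧ x ∈ P i := fun r x hx => by
    obtain ⟨i, hi, hxi⟩ := mem_iUnion₂.1 (hSM _ _ hx)
    rw [hs] at hi
    exact ⟨i, by rw [hN]; exact lt_max_of_lt_right hi, hxi⟩
  have hQlt : ∀ r r', r < r' → Disjoint (Q r) (Q r') := fun r r' hr => by
    rw [disjoint_left]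
    intro x hx hx'
    obtain ⟨i, hi, hxi⟩ := hQN r x hx
    exact disjoint_left.1 (hQP r' i (hi.trans_le (hNmono.monotone hr))) hx' hxi
  -- Only finitely many `Q r` need removal, which keeps the difference in the algebra: for `r > e i`
  -- one has `N r ≥ r > e i`, so `Q r` misses `P i` already.
  let T : ℕ ⊕ ι → Set Y := Sum.elim Q fun i => P i \ ⋃ r ∈ Finset.range (e i + 1), Q r
  have hT : IsDecomposition 𝓡 B T := by
    refine ⟨?_, ?_, ?_⟩
    · rintro (r | i)
      · exact hQ r
      · exact h𝓡.diff_mem _ (hP.mem i) _ (h𝓡.biUnion_mem _ fun r _ => hQ r)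
    · have hmix : ∀ r i, Disjoint (Q r) (P i \ ⋃ r ∈ Finset.range (e i + 1), Q r) := by
        intro r i
        by_cases hr : r < e i + 1
        · exact disjoint_sdiff_right.mono_left
            (subset_biUnion_of_mem (u := Q) (Finset.mem_coe.2 (Finset.mem_range.2 hr)))
        · refine (hQP r i ?_).mono_right sdiff_subset
          have := hNmono.le_apply (x := r)
          omega
      rintro (r | i) (r' | j) hij
      · rcases lt_or_gt_of_ne (fun h => hij (congrArg Sum.inl h) : r ≠ r') with h | h
        · exact hQlt r r' h
        · exact (hQlt r' r h).symm
      · exact hmix r j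
      · exact (hmix r' i).symm
      · exact (hP.disjoint fun h => hij (congrArg Sum.inr h)).mono sdiff_subset sdiff_subset
    · refine Subset.antisymm (iUnion_subset ?_) fun y hy => ?_
      · rintro (r | i)
        · exact h𝓡.subset _ (hQ r)
        · exact sdiff_subset.trans (h𝓡.subset _ (hP.mem i))
      · rw [← hP.iUnion_eq] at hy
        obtain ⟨i, hi⟩ := mem_iUnion.1 hy
        by_cases hyQ : ∃ r, y ∈ Q r
        · obtain ⟨r, hr⟩ := hyQ
          exact mem_iUnion.2 ⟨Sum.inl r, hr⟩
        · refine mem_iUnion.2 ⟨Sum.inr i, hi, ?_⟩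
          simp only [mem_iUnion, not_exists]
          exact fun r _ hr => hyQ ⟨r, hr⟩
  have hsum : Summable fun r => ν (Q r) :=
    (hν B h𝓡.top_mem _ T hT).summable.comp_injective Sum.inl_injective
  obtain ⟨n, hn, r₀, hr₀⟩ := eventually_mem_sub_of_summable hsum hO hK hcov
  -- Stage `Nat.pair n r₀` treats `n` and comes no earlier than `r₀`.
  have h1 := hSν (Nat.pair n r₀) (N (Nat.pair n r₀))
  rw [Nat.unpair_pair] at h1
  exact h1 hn (subset_closure (hr₀ _ (Nat.right_le_pair n r₀)))

/-! ### Atoms of a finite family -/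

/-- The part of `H` on which exactly the sets `a i`, `i ∈ G`, of the finite family `a i`, `i ∈ F`,
occur. -/
def atom {X ι : Type*} (a : ι → Set X) (F G : Finset ι) (H : Set X) : Set X :=
  {x ∈ H | ∀ i ∈ F, x ∈ a i ↔ i ∈ G}

section atom

variable {X : Type*} {ι : Type} {a : ι → Set X}

theorem atom_subset {F G : Finset ι} {H : Set X} : atom a F G H ⊆ H := fun _ h => h.1

theorem atom_subset_of_mem {F G : Finset ι} (hG : G ⊆ F) {H : Set X} {i : ι} (hi : i ∈ G) :
    atom a F G H ⊆ a i := fun _ h => (h.2 i (hG hi)).2 hi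

theorem atom_mem {𝒜 : Set (Set X)} {A : Set X} (h : IsAlgebraOn 𝒜 A) (ha : ∀ i, a i ∈ 𝒜)
    (F G : Finset ι) {H : Set X} (hH : H ∈ 𝒜) : atom a F G H ∈ 𝒜 := by
  classical
  induction F using Finset.induction_on with
  | empty => simpa [atom] using hH
  | insert i F _ ih =>
    by_cases hi : i ∈ G
    · have : atom a (insert i F) G H = atom a F G H ∩ a i := by
        ext x
        simp only [atom, Finset.forall_mem_insert, mem_ofPred_eq, mem_inter_iff, hi, iff_true]
        tauto
      rw [this]
      exact h.inter_mem _ ih _ (ha i)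
    · have : atom a (insert i F) G H = atom a F G H \ a i := by
        ext x
        simp only [atom, Finset.forall_mem_insert, mem_ofPred_eq, Set.mem_sdiff, hi, iff_false]
        tauto
      rw [this]
      exact h.diff_mem _ ih _ (ha i)

theorem disjoint_atom {F G G' : Finset ι} (hG : G ⊆ F) (hG' : G' ⊆ F) (hne : G ≠ G')
    (H : Set X) : Disjoint (atom a F G H) (atom a F G' H) := by
  refine disjoint_left.2 fun x hx hx' => hne ?_
  ext i
  by_cases hi : i ∈ F
  · rw [← hx.2 i hi, hx'.2 i hi]
  · exact ⟨fun h => absurd (hG h) hi, fun h => absurd (hG' h) hi⟩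

theorem exists_mem_atom (F : Finset ι) {H : Set X} {x : X} (hx : x ∈ H) :
    ∃ G ⊆ F, x ∈ atom a F G H := by
  classical
  exact ⟨F.filter fun i => x ∈ a i, Finset.filter_subset _ _, hx, fun i hi => by simp [hi]⟩

theorem iUnion_atom (F : Finset ι) (H : Set X) :
    ⋃ G ∈ F.powerset, atom a F G H = H := by
  refine Subset.antisymm (iUnion₂_subset fun _ _ => atom_subset) fun x hx => ?_
  obtain ⟨G, hG, hxG⟩ := exists_mem_atom (a := a) F hx
  exact mem_iUnion₂.2 ⟨G, Finset.mem_powerset.2 hG, hxG⟩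

variable {W : Type*} [AddCommGroup W] [TopologicalSpace W] [T2Space W] {𝒜 : Set (Set X)}
  {A : Set X} {μ : Set X → W}

theorem sum_atom (h : IsAlgebraOn 𝒜 A) (hμ : IsMeasureOn 𝒜 μ) (ha : ∀ i, a i ∈ 𝒜)
    (F : Finset ι) {H : Set X} (hH : H ∈ 𝒜) :
    ∑ G ∈ F.powerset, μ (atom a F G H) = μ H := by
  conv_rhs => rw [← iUnion_atom (a := a) F H]
  refine (hμ.biUnion_finset _ (fun G _ => atom_mem h ha F G hH) (fun G hG G' hG' hne => ?_)
    ?_).symm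
  · exact disjoint_atom (Finset.mem_powerset.1 hG) (Finset.mem_powerset.1 hG') hne H
  · rwa [iUnion_atom]

theorem sum_atom_inter [DecidableEq ι] (h : IsAlgebraOn 𝒜 A) (hμ : IsMeasureOn 𝒜 μ)
    (ha : ∀ i, a i ∈ 𝒜) (F : Finset ι) {H : Set X} (hH : H ∈ 𝒜) {i : ι} (hi : i ∈ F) :
    ∑ G ∈ F.powerset with i ∈ G, μ (atom a F G H) = μ (H ∩ a i) := by
  have hU : ⋃ G ∈ F.powerset.filter fun G => i ∈ G, atom a F G H = H ∩ a i := by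
    refine Subset.antisymm (iUnion₂_subset fun G hG => ?_) fun x hx => ?_
    · rw [Finset.mem_filter, Finset.mem_powerset] at hG
      exact subset_inter atom_subset (atom_subset_of_mem hG.1 hG.2)
    · obtain ⟨G, hG, hxG⟩ := exists_mem_atom (a := a) F hx.1
      exact mem_iUnion₂.2 ⟨G, Finset.mem_filter.2 ⟨Finset.mem_powerset.2 hG,
        (hxG.2 i hi).1 hx.2⟩, hxG⟩
  conv_rhs => rw [← hU]
  refine (hμ.biUnion_finset _ (fun G _ => atom_mem h ha F G hH) (fun G hG G' hG' hne => ?_)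
    ?_).symm
  · exact disjoint_atom (Finset.mem_powerset.1 (Finset.mem_filter.1 hG).1)
      (Finset.mem_powerset.1 (Finset.mem_filter.1 hG').1) hne H
  · rw [hU]
    exact h.inter_mem _ hH _ (ha i)

end atom

/-! ### Additivity over rectangles for algebras -/

/-- A countable cover of `A` by sets `D n ∈ 𝒜` carrying closed sets `K n ⊆ V`, which locally
exhaust a neighbourhood of `0`, such that all sums `∑ j, L (c j) (μ (E j))`, where the `E j ⊆ D n_j`
are disjoint and the `c j` are limits of differences of elements of `K n_j`, are in `T`. -/
structure IsSmallCover {X V W Z : Type*} [AddCommGroup V] [TopologicalSpace V] [AddCommGroup W]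
    [AddCommGroup Z] (L : V →+ W →+ Z) (𝒜 : Set (Set X)) (A : Set X) (μ : Set X → W) (T : Set Z)
    (D : ℕ → Set X) (K : ℕ → Set V) : Prop where
  mem : ∀ n, D n ∈ 𝒜
  isClosed : ∀ n, IsClosed (K n)
  zero_mem : ∀ n, (0 : V) ∈ K n
  exists_nhds : ∀ x ∈ A, ∃ O ∈ 𝓝 (0 : V), O ⊆ ⋃ n ∈ {n | x ∈ D n}, K n
  sum_mem : ∀ (κ : Type) (J : Finset κ) (E : κ → Set X) (n : κ → ℕ) (c : κ → V),
    (∀ j ∈ J, E j ∈ 𝒜) → (J : Set κ).PairwiseDisjoint E → (∀ j ∈ J, E j ⊆ D (n j)) →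
    (∀ j ∈ J, c j ∈ closure (K (n j) - K (n j))) → ∑ j ∈ J, L (c j) (μ (E j)) ∈ T

/-- A point of a nonempty atom lies in all `a i`, `i ∈ G`, which forces the corresponding `b i` to
be disjoint, so `ν` of the remainder expands. Empty atoms contribute zero to both sides. Exchanging
the sums over `G` and `i` reassembles each `H ∩ a i` from its atoms. -/
theorem sum_atom_bilinear {X Y V W Z : Type*} [AddCommGroup V] [TopologicalSpace V] [T2Space V]
    [AddCommGroup W] [TopologicalSpace W] [T2Space W] [AddCommGroup Z] {L : V →+ W →+ Z}
    {𝓡 : Set (Set Y)} {𝒜 : Set (Set X)} {B : Set Y} {A : Set X} {ν : Set Y → V} {μ : Set X → W}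
    (h𝓡 : IsAlgebraOn 𝓡 B) (h𝒜 : IsAlgebraOn 𝒜 A)
    (hν : IsMeasureOn 𝓡 ν) (hμ : IsMeasureOn 𝒜 μ) {ι : Type} {b : ι → Set Y} {a : ι → Set X}
    (hb : ∀ i, b i ∈ 𝓡) (ha : ∀ i, a i ∈ 𝒜)
    (hdisj : Pairwise fun i j => Disjoint (b i ×ˢ a i) (b j ×ˢ a j)) (F : Finset ι)
    {H : Set X} (hH : H ∈ 𝒜) :
    ∑ G ∈ F.powerset, L (ν (B \ ⋃ i ∈ G, b i)) (μ (atom a F G H)) =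
      L (ν B) (μ H) - ∑ i ∈ F, L (ν (b i)) (μ (H ∩ a i)) := by
  classical
  have h1 : ∀ G ∈ F.powerset, L (ν (B \ ⋃ i ∈ G, b i)) (μ (atom a F G H)) =
      L (ν B) (μ (atom a F G H)) - ∑ i ∈ G, L (ν (b i)) (μ (atom a F G H)) := by
    intro G hG
    rcases (atom a F G H).eq_empty_or_nonempty with h0 | ⟨x, hx⟩
    · simp [h0, hμ.empty h𝒜.empty_mem]
    · have hU : ⋃ i ∈ G, b i ∈ 𝓡 := h𝓡.biUnion_mem _ fun i _ => hb i
      rw [hν.diff hU h𝓡.top_mem (h𝓡.diff_mem _ h𝓡.top_mem _ hU) (h𝓡.subset _ hU),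
        hν.biUnion_finset _ (fun i _ => hb i) _ hU]
      · simp only [map_sub, map_sum, AddMonoidHom.sub_apply, AddMonoidHom.finsetSum_apply]
      · intro i hi j hj hij
        refine disjoint_left.2 fun y hyi hyj => ?_
        have hG' := Finset.mem_powerset.1 hG
        exact disjoint_left.1 (hdisj hij) (mk_mem_prod hyi (atom_subset_of_mem hG' hi hx))
          (mk_mem_prod hyj (atom_subset_of_mem hG' hj hx))
  rw [Finset.sum_congr rfl h1, Finset.sum_sub_distrib, ← map_sum, sum_atom h𝒜 hμ ha F hH]
  congr 1
  rw [Finset.sum_comm' (t' := F) (s' := fun i => F.powerset.filter fun G => i ∈ G)]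
  · refine Finset.sum_congr rfl fun i hi => ?_
    rw [← map_sum, sum_atom_inter h𝒜 hμ ha F hH hi]
  · intro G i
    simp only [Finset.mem_powerset, Finset.mem_filter]
    exact ⟨fun h => ⟨h, h.1 h.2⟩, fun h => h.1⟩

/-- A gliding hump: for each `k`, the pieces of `A` on which the remainders are controlled by stage
`k` contribute little to the error of `F k`. A persistent error must then come from late pieces, and
infinitely many disjoint blocks of these fit into one decomposition. -/
theorem hasSum_of_summable_refinement {X Y V W Z : Type*} [AddCommGroup V] [UniformSpace V]
    [IsUniformAddGroup V] [CompleteSpace V] [T2Space V] [AddCommGroup W] [TopologicalSpace W]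
    [T2Space W] [AddCommGroup Z] [UniformSpace Z] [IsUniformAddGroup Z] {L : V →+ W →+ Z}
    {𝓡 : Set (Set Y)} {𝒜 : Set (Set X)} {B : Set Y} {A : Set X} {ν : Set Y → V} {μ : Set X → W}
    (h𝓡 : IsAlgebraOn 𝓡 B) (h𝒜 : IsAlgebraOn 𝒜 A)
    (hν : IsMeasureOn 𝓡 ν) (hμ : IsMeasureOn 𝒜 μ) (hL : ∀ v : V, Continuous fun w : W => L v w)
    (hsv : ∀ T ∈ 𝓝 (0 : Z), ∃ D K, IsSmallCover L 𝒜 A μ T D K)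
    {ι : Type} [Countable ι] {b : ι → Set Y} {a : ι → Set X}
    (hb : ∀ i, b i ∈ 𝓡) (ha : ∀ i, a i ∈ 𝒜)
    (hdisj : Pairwise fun i j => Disjoint (b i ×ˢ a i) (b j ×ˢ a j))
    (hU : ⋃ i, b i ×ˢ a i = B ×ˢ A)
    (hsummable : ∀ (κ : Type) [Countable κ] (H : κ → Set X) (G : κ → Finset ι),
      IsDecomposition 𝒜 A H → (∀ q, ∀ i ∈ G q, H q ⊆ a i) →
        Summable fun q => L (ν (B \ ⋃ i ∈ G q, b i)) (μ (H q))) :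
    HasSum (fun i => L (ν (b i)) (μ (a i))) (L (ν B) (μ A)) := by
  classical
  obtain ⟨e, he⟩ := exists_injective_nat ι
  let s : ℕ → Finset ι := fun M => (Finset.range M).preimage e he.injOn
  have hs : ∀ M i, i ∈ s M ↔ e i < M := fun M i => by simp [s]
  by_contra hcon
  -- a neighbourhood that is missed again and again
  obtain ⟨T, hT, hTF⟩ : ∃ T ∈ 𝓝 (0 : Z), ∀ F₀ : Finset ι, ∃ F, F₀ ⊆ F ∧
      L (ν B) (μ A) - ∑ i ∈ F, L (ν (b i)) (μ (a i)) ∉ T := by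
    by_contra! h
    refine hcon ?_
    rw [HasSum, SummationFilter.unconditional_filter]
    have h0 : Tendsto (fun F : Finset ι => L (ν B) (μ A) - ∑ i ∈ F, L (ν (b i)) (μ (a i))) atTop
        (𝓝 0) := fun T hT => by
      obtain ⟨F₀, hF₀⟩ := h T hT
      exact mem_map.2 (mem_atTop_sets.2 ⟨F₀, hF₀⟩)
    simpa using h0.const_sub (L (ν B) (μ A))
  obtain ⟨T₀, hT₀, hT₀c, hT₀T⟩ := exists_mem_nhds_isClosed_subset hT
  obtain ⟨T₂, hT₂, hT₂T₀⟩ := exists_nhds_zero_half hT₀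
  obtain ⟨D, K, hDK⟩ := hsv T₂ hT₂
  choose F hsF hFT using fun k => hTF (s k)
  have hF : ∀ k i, e i < k → i ∈ F k := fun k i hi => hsF k ((hs k i).2 hi)
  -- the decomposition on which the tails are uniformly small
  let Good : ℕ × ℕ × Finset ι → Prop := fun p => (∀ i ∈ p.2.2, e i < p.2.1) ∧
    ∀ S ∈ 𝓡, (∀ i ∈ p.2.2, Disjoint S (b i)) → ν S ∈ closure (K p.1 - K p.1)
  have hcover : A ⊆ ⋃ p : {p // Good p}, D p.1.1 ∩ ⋂ i ∈ p.1.2.2, a i := by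
    intro x hx
    obtain ⟨O, hO, hOK⟩ := hDK.exists_nhds x hx
    have hP : IsDecomposition 𝓡 B fun i : {i // x ∈ a i} => b i := by
      refine ⟨fun i => hb i, fun i j hij => disjoint_left.2 fun y hyi hyj => ?_, ?_⟩
      · exact disjoint_left.1 (hdisj fun h => hij (Subtype.ext h)) (mk_mem_prod hyi i.2)
          (mk_mem_prod hyj j.2)
      · refine Subset.antisymm (iUnion_subset fun i => h𝓡.subset _ (hb i)) fun y hy => ?_
        have : (y, x) ∈ ⋃ i, b i ×ˢ a i := by rw [hU]; exact ⟨hy, hx⟩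
        obtain ⟨i, hi⟩ := mem_iUnion.1 this
        exact mem_iUnion.2 ⟨⟨i, hi.2⟩, hi.1⟩
    obtain ⟨n, hn, N, hN⟩ := exists_tail_mem_closure_sub h𝓡 hν
      (he.comp Subtype.val_injective) hP hO hDK.isClosed hOK
    refine mem_iUnion.2 ⟨⟨(n, N, (s N).filter fun i => x ∈ a i), fun i hi => ?_,
      fun S hS hSd => ?_⟩, hn, ?_⟩
    · exact (hs N i).1 (Finset.mem_filter.1 hi).1
    · exact hN S hS fun i hi => hSd i (Finset.mem_filter.2 ⟨(hs N i).2 hi, i.2⟩)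
    · exact mem_iInter₂.2 fun i hi => (Finset.mem_filter.1 hi).2
  obtain ⟨H, hH, hHsub⟩ := h𝒜.exists_isDecomposition_subset
    (fun p : {p // Good p} => h𝒜.inter_biInter_mem p.1.2.2 (fun i _ => ha i) (hDK.mem p.1.1))
    hcover
  let N : {p // Good p} → ℕ := fun p => p.1.2.1
  let t : ℕ → {p // Good p} → Z := fun k p =>
    ∑ G ∈ (F k).powerset, L (ν (B \ ⋃ i ∈ G, b i)) (μ (atom a (F k) G (H p)))
  have ht_sum : ∀ k, HasSum (t k) (L (ν B) (μ A) - ∑ i ∈ F k, L (ν (b i)) (μ (a i))) := by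
    intro k
    have : t k = fun p => L (ν B) (μ (H p)) - ∑ i ∈ F k, L (ν (b i)) (μ (H p ∩ a i)) :=
      funext fun p => sum_atom_bilinear h𝓡 h𝒜 hν hμ hb ha hdisj (F k) (hH.mem p)
    rw [this]
    refine HasSum.sub ((hμ A h𝒜.top_mem _ H hH).map (L (ν B)) (hL _))
      (hasSum_sum fun i _ => ?_)
    refine HasSum.map (hμ (a i) (ha i) _ (fun p => H p ∩ a i) ⟨fun p => h𝒜.inter_mem _ (hH.mem p)
      _ (ha i), fun p q hpq => (hH.disjoint hpq).mono inter_subset_left inter_subset_left, ?_⟩)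
      (L (ν (b i))) (hL _)
    rw [← iUnion_inter, hH.iUnion_eq, inter_eq_right.2 (h𝒜.subset _ (ha i))]
  -- If `N p ≤ k`, then `F k` contains the finite set of the triple `p`. As `H p` lies in the
  -- corresponding `a i`, any nonempty atom inside it removes all the required `b i`.
  have ht_small : ∀ k (J : Finset {p // Good p}), (∀ p ∈ J, N p ≤ k) → ∑ p ∈ J, t k p ∈ T₂ := by
    intro k J hJ
    have := hDK.sum_mem ({p // Good p} × Finset ι) (J ×ˢ (F k).powerset)
      (fun q => atom a (F k) q.2 (H q.1)) (fun q => q.1.1.1)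
      -- On empty atoms the remainder is not controlled, so its coefficient is set to zero.
      (fun q => if (atom a (F k) q.2 (H q.1)).Nonempty then ν (B \ ⋃ i ∈ q.2, b i) else 0)
      (fun q _ => atom_mem h𝒜 ha _ _ (hH.mem _)) ?_ ?_ ?_
    · rw [Finset.sum_product] at this
      convert this using 2 with p hp
      refine Finset.sum_congr rfl fun G hG => ?_
      dsimp only
      split_ifs with hne
      · rfl
      · rw [not_nonempty_iff_eq_empty.1 hne, hμ.empty h𝒜.empty_mem, map_zero, map_zero]
    · rintro ⟨p, G⟩ hq ⟨p', G'⟩ hq' hne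
      rw [Finset.mem_coe, Finset.mem_product, Finset.mem_powerset] at hq hq'
      by_cases hp : p = p'
      · subst hp
        exact disjoint_atom hq.2 hq'.2 (fun h => hne (Prod.ext rfl h)) _
      · exact (hH.disjoint hp).mono atom_subset atom_subset
    · exact fun q _ => (atom_subset.trans (hHsub q.1)).trans inter_subset_left
    · rintro ⟨p, G⟩ hq
      rw [Finset.mem_product, Finset.mem_powerset] at hq
      dsimp only
      split_ifs with hne
      · obtain ⟨x, hx⟩ := hne
        refine p.2.2 _ (h𝓡.diff_mem _ h𝓡.top_mem _ (h𝓡.biUnion_mem _ fun i _ => hb i))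
          fun i hi => ?_
        have hxi : x ∈ a i := mem_iInter₂.1 (hHsub p hx.1).2 i hi
        have hiF : i ∈ F k := hF k i ((p.2.1 i hi).trans_le (hJ p hq.1))
        exact disjoint_sdiff_left.mono_right
          (subset_biUnion_of_mem (u := b) (Finset.mem_coe.2 ((hx.2 i hiF).1 hxi)))
      · exact subset_closure ⟨0, hDK.zero_mem _, 0, hDK.zero_mem _, sub_zero 0⟩
  -- If all late finite sums were in `T₂`, every finite sum would lie in `T₂ + T₂ ⊆ T₀`, and so
  -- would the limit, since `T₀` is closed.
  have ht_big : ∀ k, ∃ J : Finset {p // Good p}, (∀ p ∈ J, k < N p) ∧ ∑ p ∈ J, t k p ∉ T₂ := by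
    intro k
    by_contra! h
    refine hFT k (hT₀T (hT₀c.mem_of_tendsto (ht_sum k) (Eventually.of_forall fun J => ?_)))
    rw [← Finset.sum_filter_add_sum_filter_not J fun p => N p ≤ k]
    exact hT₂T₀ _ (ht_small k _ fun p hp => (Finset.mem_filter.1 hp).2) _
      (h _ fun p hp => not_le.1 (Finset.mem_filter.1 hp).2)
  choose J hJN hJT using ht_big
  -- disjoint blocks with large sums
  let φ : ℕ → ℕ := fun r => Nat.rec 0 (fun _ k => max (k + 1) ((J k).sup N)) r
  have hφ : ∀ r, φ (r + 1) = max (φ r + 1) ((J (φ r)).sup N) := fun r => rfl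
  have hφmono : StrictMono φ := strictMono_nat_of_lt_succ fun r => by rw [hφ]; omega
  have hJlt : ∀ r r', r < r' → ∀ p ∈ J (φ r), p ∉ J (φ r') := by
    intro r r' hr p hp hp'
    have h1 := hJN _ p hp'
    have h2 : N p ≤ φ (r + 1) := by
      rw [hφ]; exact (Finset.le_sup (f := N) hp).trans (le_max_right _ _)
    have h3 := hφmono.monotone (Nat.succ_le_of_lt hr)
    rw [Nat.succ_eq_add_one] at h3
    omega
  -- The blocks are disjoint, so each `p` is cut by the `F` of at most one block; outside the blocks
  -- `∅` leaves `H p` uncut.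
  let Ψ : {p // Good p} → Finset ι := fun p =>
    if h : ∃ r, p ∈ J (φ r) then F (φ h.choose) else ∅
  have hΨ : ∀ r, ∀ p ∈ J (φ r), Ψ p = F (φ r) := by
    intro r p hp
    have hex : ∃ r, p ∈ J (φ r) := ⟨r, hp⟩
    have : hex.choose = r := by
      by_contra hne
      rcases lt_or_gt_of_ne hne with h | h
      · exact hJlt _ _ h p hex.choose_spec hp
      · exact hJlt _ _ h p hp hex.choose_spec
    simp only [Ψ, dif_pos hex, this]
  -- An atom depends only on the part of `G` inside `Ψ p`; the value `∅` for other `G` prevents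
  -- repetitions.
  let H' : {p // Good p} × Finset ι → Set X := fun q =>
    if q.2 ⊆ Ψ q.1 then atom a (Ψ q.1) q.2 (H q.1) else ∅
  have hH' : IsDecomposition 𝒜 A H' := by
    refine ⟨fun q => ?_, ?_, ?_⟩
    · simp only [H']
      split_ifs
      · exact atom_mem h𝒜 ha _ _ (hH.mem _)
      · exact h𝒜.empty_mem
    · rintro ⟨p, G⟩ ⟨p', G'⟩ hne
      simp only [H']
      split_ifs with h1 h2
      · by_cases hp : p = p'
        · subst hp
          exact disjoint_atom h1 h2 (fun h => hne (Prod.ext rfl h)) _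
        · exact (hH.disjoint hp).mono atom_subset atom_subset
      all_goals simp
    · rw [← hH.iUnion_eq]
      refine Subset.antisymm (iUnion_subset fun q => ?_) (iUnion_subset fun p x hx => ?_)
      · simp only [H']
        split_ifs
        · exact atom_subset.trans (subset_iUnion _ _)
        · exact empty_subset _
      · obtain ⟨G, hG, hxG⟩ := exists_mem_atom (a := a) (Ψ p) hx
        refine mem_iUnion.2 ⟨(p, G), ?_⟩
        simpa only [H', if_pos hG] using hxG
  have hsum := hsummable _ H' (fun q => q.2) hH' fun q i hi => by
    simp only [H']
    split_ifs with h1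
    · exact atom_subset_of_mem h1 hi
    · exact empty_subset _
  -- A block with `φ r` above all `N` occurring in `u` is disjoint from `u`, so its sum would be in
  -- `T₂`.
  obtain ⟨u, hu⟩ := hsum.vanishing hT₂
  obtain ⟨r, hr⟩ : ∃ r, ∀ q ∈ u, N q.1 ≤ φ r :=
    ⟨u.sup fun q => N q.1, fun q hq =>
      (Finset.le_sup (f := fun q : {p // Good p} × Finset ι => N q.1) hq).trans hφmono.le_apply⟩
  refine hJT (φ r) ?_
  have hblock := hu (J (φ r) ×ˢ (F (φ r)).powerset) (Finset.disjoint_left.2 fun q hq hqu => by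
    have h1 := hJN _ _ (Finset.mem_product.1 hq).1
    have h2 := hr q hqu
    omega)
  rw [Finset.sum_product] at hblock
  convert hblock using 2 with p hp
  refine Finset.sum_congr rfl fun G hG => ?_
  simp only [H', hΨ r p hp, if_pos (Finset.mem_powerset.1 hG)]

/-- The sets `H p ×ˢ Q p` and `H p ×ˢ (B \ Q p)` partition `A ×ˢ B`, so
`hasSum_of_summable_refinement` applies to `L.flip`. Here removing finitely many first sides leaves
a union of the other `H p`, so its summability hypothesis reduces to a grid. -/
theorem summable_of_grid {X Y V W Z : Type*} [AddCommGroup V] [TopologicalSpace V]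
    [T2Space V] [AddCommGroup W] [UniformSpace W]
    [IsUniformAddGroup W] [CompleteSpace W] [T2Space W] [AddCommGroup Z] [UniformSpace Z]
    [IsUniformAddGroup Z] [CompleteSpace Z] [T2Space Z] {L : V →+ W →+ Z} {𝓡 : Set (Set Y)}
    {𝒜 : Set (Set X)} {B : Set Y} {A : Set X} {ν : Set Y → V} {μ : Set X → W}
    (h𝓡 : IsAlgebraOn 𝓡 B) (h𝒜 : IsAlgebraOn 𝒜 A)
    (hν : IsMeasureOn 𝓡 ν) (hμ : IsMeasureOn 𝒜 μ)
    (hL_right : ∀ v : V, Continuous fun w : W => L v w)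
    (hL_left : ∀ w : W, Continuous fun v : V => L v w)
    (hsv : ∀ T ∈ 𝓝 (0 : Z), ∃ D K, IsSmallCover L.flip 𝓡 B ν T D K)
    (hgrid : ∀ (Γ Λ : Type) [Countable Γ] [Countable Λ] (P : Γ → Set Y) (Q : Λ → Set X),
      IsDecomposition 𝓡 B P → IsDecomposition 𝒜 A Q →
        Summable fun p : Γ × Λ => L (ν (P p.1)) (μ (Q p.2)))
    {π : Type} [Countable π] {H : π → Set X} (hH : IsDecomposition 𝒜 A H) {Q : π → Set Y}
    (hQ : ∀ p, Q p ∈ 𝓡) : Summable fun p => L (ν (Q p)) (μ (H p)) := by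
  classical
  let a : π × Bool → Set Y := fun i => bif i.2 then Q i.1 else B \ Q i.1
  have hsum := hasSum_of_summable_refinement (L := L.flip) (b := fun i : π × Bool => H i.1)
    (a := a) h𝒜 h𝓡 hμ hν hL_left hsv (fun i => hH.mem _) ?_ ?_ ?_ ?_
  · exact hsum.summable.comp_injective (i := fun p => (p, true)) fun p q h => congrArg Prod.fst h
  · rintro ⟨p, _ | _⟩
    · exact h𝓡.diff_mem _ h𝓡.top_mem _ (hQ p)
    · exact hQ p
  · rintro ⟨p, c⟩ ⟨q, d⟩ hpq
    by_cases h : p = q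
    · subst h
      refine Disjoint.set_prod_right ?_ _ _
      cases c <;> cases d
      · exact absurd rfl hpq
      · exact disjoint_sdiff_left
      · exact disjoint_sdiff_right
      · exact absurd rfl hpq
    · exact Disjoint.set_prod_left (hH.disjoint h) _ _
  · ext ⟨x, y⟩
    simp only [mem_iUnion, mem_prod, Prod.exists, Bool.exists_bool, a, cond_true, cond_false,
      ← hH.iUnion_eq, Set.mem_sdiff]
    constructor
    · rintro ⟨p, h | h⟩
      · exact ⟨⟨p, h.1⟩, h.2.1⟩
      · exact ⟨⟨p, h.1⟩, h𝓡.subset _ (hQ p) h.2⟩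
    · rintro ⟨⟨p, hp⟩, hy⟩
      refine ⟨p, ?_⟩
      tauto
  · intro κ _ P G hP _
    let H' : κ → π → Set X := fun q p => if p ∈ (G q).image Prod.fst then ∅ else H p
    have hH' : ∀ q, HasSum (fun p => L (ν (P q)) (μ (H' q p)))
        (L (ν (P q)) (μ (A \ ⋃ i ∈ G q, H i.1))) := fun q => by
      refine HasSum.map (hμ _ (h𝒜.diff_mem _ h𝒜.top_mem _ (h𝒜.biUnion_mem _ fun i _ => hH.mem _))
        π (H' q) ⟨fun p => ?_, fun p p' hp => ?_, ?_⟩) (L (ν (P q))) (hL_right _)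
      · simp only [H']
        split_ifs
        exacts [h𝒜.empty_mem, hH.mem p]
      · refine (hH.disjoint hp).mono ?_ ?_ <;>
        · simp only [H']
          split_ifs
          exacts [empty_subset _, Subset.rfl]
      · ext x
        simp only [mem_iUnion, Set.mem_sdiff, H', ← hH.iUnion_eq]
        constructor
        · rintro ⟨p, hp⟩
          split_ifs at hp with h
          · exact absurd hp (notMem_empty x)
          · refine ⟨⟨p, hp⟩, ?_⟩
            rintro ⟨i, hi, hxi⟩
            by_cases hip : i.1 = p
            · exact h (Finset.mem_image.2 ⟨i, hi, hip⟩)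
            · exact disjoint_left.1 (hH.disjoint hip) hxi hp
        · rintro ⟨⟨p, hp⟩, hx⟩
          refine ⟨p, ?_⟩
          rw [if_neg]
          · exact hp
          · intro h
            obtain ⟨i, hi, rfl⟩ := Finset.mem_image.1 h
            exact hx ⟨i, hi, hp⟩
    -- This is the grid `P`, `H` with some entries replaced by zero; summing its rows gives the
    -- required family.
    have h1 : Summable fun r : κ × π => L (ν (P r.1)) (μ (H' r.1 r.2)) := by
      convert (hgrid κ π P H hP hH).indicator {r | r.2 ∉ (G r.1).image Prod.fst} using 2 with r
      by_cases h : r.2 ∈ (G r.1).image Prod.fst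
      · rw [indicator_of_notMem (show r ∉ {r | r.2 ∉ (G r.1).image Prod.fst} from not_not.2 h)]
        simp only [H', if_pos h, hμ.empty h𝒜.empty_mem, map_zero]
      · rw [indicator_of_mem (show r ∈ {r | r.2 ∉ (G r.1).image Prod.fst} from h)]
        simp only [H', if_neg h]
    exact h1.prod.congr fun q => (hH' q).tsum_eq

/-- Additivity over rectangles for algebras of sets. -/
theorem hasSum_of_grid {X Y V W Z : Type*} [AddCommGroup V] [UniformSpace V]
    [IsUniformAddGroup V] [CompleteSpace V] [T2Space V] [AddCommGroup W] [UniformSpace W]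
    [IsUniformAddGroup W] [CompleteSpace W] [T2Space W] [AddCommGroup Z] [UniformSpace Z]
    [IsUniformAddGroup Z] [CompleteSpace Z] [T2Space Z] {L : V →+ W →+ Z} {𝓡 : Set (Set Y)}
    {𝒜 : Set (Set X)} {B : Set Y} {A : Set X} {ν : Set Y → V} {μ : Set X → W}
    (h𝓡 : IsAlgebraOn 𝓡 B) (h𝒜 : IsAlgebraOn 𝒜 A)
    (hν : IsMeasureOn 𝓡 ν) (hμ : IsMeasureOn 𝒜 μ)
    (hL_right : ∀ v : V, Continuous fun w : W => L v w)
    (hL_left : ∀ w : W, Continuous fun v : V => L v w)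
    (hsvν : ∀ T ∈ 𝓝 (0 : Z), ∃ D K, IsSmallCover L.flip 𝓡 B ν T D K)
    (hsvμ : ∀ T ∈ 𝓝 (0 : Z), ∃ D K, IsSmallCover L 𝒜 A μ T D K)
    (hgrid : ∀ (Γ Λ : Type) [Countable Γ] [Countable Λ] (P : Γ → Set Y) (Q : Λ → Set X),
      IsDecomposition 𝓡 B P → IsDecomposition 𝒜 A Q →
        Summable fun p : Γ × Λ => L (ν (P p.1)) (μ (Q p.2)))
    {ι : Type} [Countable ι] {b : ι → Set Y} {a : ι → Set X}
    (hb : ∀ i, b i ∈ 𝓡) (ha : ∀ i, a i ∈ 𝒜)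
    (hdisj : Pairwise fun i j => Disjoint (b i ×ˢ a i) (b j ×ˢ a j))
    (hU : ⋃ i, b i ×ˢ a i = B ×ˢ A) :
    HasSum (fun i => L (ν (b i)) (μ (a i))) (L (ν B) (μ A)) :=
  hasSum_of_summable_refinement h𝓡 h𝒜 hν hμ hL_right hsvμ hb ha hdisj hU
    fun _ _ _ _ hH _ => summable_of_grid h𝓡 h𝒜 hν hμ hL_right hL_left hsvν hgrid hH
      fun _ => h𝓡.diff_mem _ h𝓡.top_mem _ (h𝓡.biUnion_mem _ fun i _ => hb i)

/-! ### From interval systems to algebras -/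

/-- `E` is a countable disjoint union of members of `S`. -/
def IsDecomposable {X : Type*} (S : Set (Set X)) (E : Set X) : Prop :=
  ∃ (ι : Type) (_ : Countable ι) (P : ι → Set X), IsDecomposition S E P

section decomposable

variable {X : Type*} {S : Set (Set X)}

theorem isDecomposition_unit {E : Set X} (hE : E ∈ S) :
    IsDecomposition S E fun _ : Unit => E :=
  ⟨fun _ => hE, fun _ _ h => absurd rfl h, iUnion_const _⟩

theorem IsDecomposable.of_mem {E : Set X} (hE : E ∈ S) : IsDecomposable S E :=
  ⟨Unit, inferInstance, _, isDecomposition_unit hE⟩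

theorem isDecomposable_empty : IsDecomposable S ∅ :=
  ⟨Empty, inferInstance, fun i => i.elim, fun i => i.elim, fun i => i.elim, by simp⟩

theorem IsDecomposition.sigma {𝒜 : Set (Set X)} {ι : Type} {E : Set X} {F : ι → Set X}
    (hF : IsDecomposition 𝒜 E F) {κ : ι → Type} {P : ∀ i, κ i → Set X}
    (hP : ∀ i, IsDecomposition S (F i) (P i)) :
    IsDecomposition S E fun p : Σ i, κ i => P p.1 p.2 := by
  refine ⟨fun p => (hP p.1).mem p.2, ?_, ?_⟩
  · rintro ⟨i, k⟩ ⟨j, l⟩ hne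
    by_cases h : i = j
    · subst h
      exact (hP i).disjoint fun h : k = l => hne (by rw [h])
    · refine (hF.disjoint h).mono ?_ ?_
      · rw [← (hP i).iUnion_eq]; exact subset_iUnion (P i) k
      · rw [← (hP j).iUnion_eq]; exact subset_iUnion (P j) l
  · rw [iUnion_sigma, ← hF.iUnion_eq]
    exact iUnion_congr fun i => (hP i).iUnion_eq

theorem IsDecomposition.sumElim {A E : Set X} {ι κ : Type} {P : ι → Set X} {Q : κ → Set X}
    (hP : IsDecomposition S E P) (hQ : IsDecomposition S (A \ E) Q) (hEA : E ⊆ A) :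
    IsDecomposition S A (Sum.elim P Q) := by
  have hPE : ∀ i, P i ⊆ E := fun i => hP.iUnion_eq ▸ subset_iUnion P i
  have hQE : ∀ k, Q k ⊆ A \ E := fun k => hQ.iUnion_eq ▸ subset_iUnion Q k
  refine ⟨?_, ?_, ?_⟩
  · rintro (i | k)
    exacts [hP.mem i, hQ.mem k]
  · rintro (i | i) (j | j) hij
    · exact hP.disjoint fun h => hij (by rw [h])
    · exact disjoint_sdiff_right.mono (hPE i) (hQE j)
    · exact disjoint_sdiff_left.mono (hQE i) (hPE j)
    · exact hQ.disjoint fun h => hij (by rw [h])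
  · rw [iUnion_sum]
    simp only [Sum.elim_inl, Sum.elim_inr]
    rw [hP.iUnion_eq, hQ.iUnion_eq, union_sdiff_cancel hEA]

theorem IsDecomposable.iUnion {ι : Type} [Countable ι] {F : ι → Set X}
    (hF : ∀ i, IsDecomposable S (F i)) (hd : Pairwise fun i j => Disjoint (F i) (F j)) :
    IsDecomposable S (⋃ i, F i) := by
  choose κ hκ P hP using hF
  exact ⟨Σ i, κ i, inferInstance, _,
    IsDecomposition.sigma (𝒜 := univ) ⟨fun _ => mem_univ _, hd, rfl⟩ hP⟩

theorem IsDecomposable.union {E F : Set X} (hE : IsDecomposable S E) (hF : IsDecomposable S F)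
    (hd : Disjoint E F) : IsDecomposable S (E ∪ F) := by
  rw [union_eq_iUnion]
  refine IsDecomposable.iUnion (fun b => by cases b <;> assumption) ?_
  rintro (_ | _) (_ | _) hb
  exacts [absurd rfl hb, hd.symm, hd, absurd rfl hb]

theorem isDecomposable_sUnion {C : Set (Set X)} (hCS : C ⊆ S) (hC : C.Countable)
    (hd : C.PairwiseDisjoint id) : IsDecomposable S (⋃₀ C) := by
  have : Countable C := hC.to_subtype
  obtain ⟨f, hf⟩ := exists_injective_nat C
  let g := (Equiv.ofInjective f hf).symm
  refine ⟨range f, inferInstance, fun i => g i, fun i => hCS (g i).2, fun i j hij => ?_, ?_⟩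
  · exact hd (g i).2 (g j).2 fun h => hij (g.injective (Subtype.ext h))
  · rw [sUnion_eq_iUnion, ← g.surjective.iUnion_comp]

theorem IsIntervalSystem.isDecomposable_diff (hS : IsIntervalSystem S) {E F : Set X} (hE : E ∈ S)
    (hF : F ∈ S) : IsDecomposable S (E \ F) := by
  obtain ⟨⟨C, h1, h2, h3, h4⟩, -⟩ := hS E hE F hF
  exact h4 ▸ isDecomposable_sUnion h1 h2 h3

theorem IsIntervalSystem.isDecomposable_inter_of_mem (hS : IsIntervalSystem S) {E F : Set X}
    (hE : E ∈ S) (hF : F ∈ S) : IsDecomposable S (E ∩ F) := by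
  obtain ⟨-, C, h1, h2, h3, h4⟩ := hS E hE F hF
  exact h4 ▸ isDecomposable_sUnion h1 h2 h3

theorem IsIntervalSystem.isDecomposable_inter (hS : IsIntervalSystem S) {E F : Set X}
    (hE : IsDecomposable S E) (hF : IsDecomposable S F) : IsDecomposable S (E ∩ F) := by
  obtain ⟨ι, _, P, hP⟩ := hE
  obtain ⟨κ, _, Q, hQ⟩ := hF
  have : E ∩ F = ⋃ p : ι × κ, P p.1 ∩ Q p.2 := by
    rw [← hP.iUnion_eq, ← hQ.iUnion_eq, iUnion_inter_iUnion, iUnion_prod']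
  rw [this]
  refine IsDecomposable.iUnion
    (fun p => hS.isDecomposable_inter_of_mem (hP.mem p.1) (hQ.mem p.2)) ?_
  rintro ⟨i, k⟩ ⟨j, l⟩ hne
  by_cases h : i = j
  · subst h
    exact (hQ.disjoint fun h : k = l => hne (by rw [h])).mono inter_subset_right inter_subset_right
  · exact (hP.disjoint h).mono inter_subset_left inter_subset_left

/-- The algebra of those subsets of `A` which are, together with their complements in `A`,
countable disjoint unions of members of `S`. -/
def localAlgebra (S : Set (Set X)) (A : Set X) : Set (Set X) :=
  {E | E ⊆ A ∧ IsDecomposable S E ∧ IsDecomposable S (A \ E)}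

theorem isAlgebraOn_localAlgebra (hS : IsIntervalSystem S) {A : Set X} (hA : A ∈ S) :
    IsAlgebraOn (localAlgebra S A) A := by
  refine ⟨⟨Subset.rfl, .of_mem hA, by rw [sdiff_self]; exact isDecomposable_empty⟩,
    fun E hE => hE.1, fun E hE F hF => ⟨inter_subset_left.trans hE.1,
      hS.isDecomposable_inter hE.2.1 hF.2.1, ?_⟩, fun E hE F hF => ⟨sdiff_subset.trans hE.1, ?_, ?_⟩⟩
  · have : A \ (E ∩ F) = (A \ E) ∪ (E ∩ (A \ F)) := by
      ext x
      have := @hE.1 x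
      simp only [Set.mem_sdiff, mem_inter_iff, mem_union]
      tauto
    rw [this]
    exact hE.2.2.union (hS.isDecomposable_inter hE.2.1 hF.2.2)
      (disjoint_sdiff_left.mono_right inter_subset_left)
  · have : E \ F = E ∩ (A \ F) := by
      ext x
      have := @hE.1 x
      simp only [Set.mem_sdiff, mem_inter_iff]
      tauto
    rw [this]
    exact hS.isDecomposable_inter hE.2.1 hF.2.2
  · have : A \ (E \ F) = (A \ E) ∪ (E ∩ F) := by
      ext x
      have := @hE.1 x
      simp only [Set.mem_sdiff, mem_inter_iff, mem_union]
      tauto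
    rw [this]
    exact hE.2.2.union (hS.isDecomposable_inter hE.2.1 hF.2.1)
      (disjoint_sdiff_left.mono_right inter_subset_left)

theorem mem_localAlgebra (hS : IsIntervalSystem S) {A E : Set X} (hA : A ∈ S) (hE : E ∈ S)
    (hEA : E ⊆ A) : E ∈ localAlgebra S A :=
  ⟨hEA, .of_mem hE, hS.isDecomposable_diff hA hE⟩

theorem inter_mem_localAlgebra (hS : IsIntervalSystem S) {A E : Set X} (hA : A ∈ S)
    (hE : E ∈ S) : E ∩ A ∈ localAlgebra S A :=
  ⟨inter_subset_right, hS.isDecomposable_inter_of_mem hE hA, by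
    rw [inter_comm, sdiff_self_inter]; exact hS.isDecomposable_diff hA hE⟩

variable {W : Type*} [AddCommGroup W]

open Classical in
/-- The extension of `μ` to countable disjoint unions. -/
noncomputable def extend [TopologicalSpace W] (S : Set (Set X)) (μ : Set X → W) (E : Set X) : W :=
  if h : IsDecomposable S E then ∑' i, μ (h.choose_spec.choose_spec.choose i) else 0

variable [UniformSpace W] [IsUniformAddGroup W] [CompleteSpace W] [T2Space W] {μ : Set X → W}

/-- A fixed decomposition `Q` of `A \ E` completes any decomposition of `E` to one of `A`. Hence the
sum over `E` is `μ A` minus the sum over `Q`, whichever decomposition of `E` is used. -/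
theorem IsMeasureOn.hasSum_extend (hμ : IsMeasureOn S μ) {A E : Set X} (hA : A ∈ S)
    (hE : E ∈ localAlgebra S A) {ι : Type} [Countable ι] {P : ι → Set X}
    (hP : IsDecomposition S E P) : HasSum (fun i => μ (P i)) (extend S μ E) := by
  obtain ⟨hEA, hEd, κ, _, Q, hQ⟩ := hE
  have key : ∀ {ι : Type} [Countable ι] {P : ι → Set X}, IsDecomposition S E P →
      HasSum (fun i => μ (P i)) (μ A - ∑' k, μ (Q k)) := by
    intro ι _ P hP
    have hd := hP.sumElim hQ hEA
    have hsum := hμ A hA _ _ hd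
    have h1 : Summable fun i => μ (P i) := hsum.summable.comp_injective Sum.inl_injective
    have h2 : Summable fun k => μ (Q k) := hsum.summable.comp_injective Sum.inr_injective
    have h3 := hsum.unique (HasSum.sum (f := fun i => μ (Sum.elim P Q i)) h1.hasSum h2.hasSum)
    rw [h3, add_sub_cancel_right]
    exact h1.hasSum
  have hext : extend S μ E = μ A - ∑' k, μ (Q k) := by
    rw [extend, dif_pos hEd]
    have := hEd.choose_spec.choose
    exact (key hEd.choose_spec.choose_spec.choose_spec).tsum_eq
  rw [hext]
  exact key hP

theorem IsMeasureOn.extend_eq (hμ : IsMeasureOn S μ) (hS : IsIntervalSystem S) {A E : Set X}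
    (hA : A ∈ S) (hE : E ∈ S) (hEA : E ⊆ A) : extend S μ E = μ E :=
  (hμ.hasSum_extend hA (mem_localAlgebra hS hA hE hEA) (isDecomposition_unit hE)).unique
    (hasSum_unique _)

theorem IsMeasureOn.isMeasureOn_extend (hμ : IsMeasureOn S μ) {A : Set X} (hA : A ∈ S) :
    IsMeasureOn (localAlgebra S A) (extend S μ) := by
  intro E hE ι _ F hF
  choose κ hκ P hP using fun i => (hF.mem i).2.1
  exact (hμ.hasSum_extend hA hE (hF.sigma hP)).sigma
    fun i => hμ.hasSum_extend hA (hF.mem i) (hP i)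

end decomposable

/-! ### Small covers from finite semivariation -/

theorem finsetSum_mem_of_forall_mem_closure {Z κ : Type*} [AddCommGroup Z] [TopologicalSpace Z]
    [ContinuousAdd Z] {J : Finset κ} {U : κ → Set Z} {Q : Set Z} (hQ : IsClosed Q)
    (h : ∀ z : κ → Z, (∀ j ∈ J, z j ∈ U j) → ∑ j ∈ J, z j ∈ Q) {z : κ → Z}
    (hz : ∀ j ∈ J, z j ∈ closure (U j)) : ∑ j ∈ J, z j ∈ Q := by
  have hc : Continuous fun z : κ → Z => ∑ j ∈ J, z j := by fun_prop
  have hz' : z ∈ closure ((J : Set κ).pi U) := by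
    rw [closure_pi_set]
    exact hz
  rw [← hQ.closure_eq]
  exact map_mem_closure hc hz' fun z hz => h z hz

section semivariation

variable {X V W Z : Type*} [AddCommGroup V] [TopologicalSpace V] [AddCommGroup W]
  [UniformSpace W] [IsUniformAddGroup W] [CompleteSpace W] [T2Space W]
  [AddCommGroup Z] [UniformSpace Z] [IsUniformAddGroup Z]
  {L : V →+ W →+ Z} {S : Set (Set X)} {μ : Set X → W} {A : Set X}

/-- Two approximations lead to admissible step functions: the `c j` by elements of the common
fibres, then the extended measures by finite partial sums over members of `S`. The pieces being
disjoint, the step function takes at each point a single coefficient or zero, both in the fibre of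
the pointed set `C`. -/
theorem sum_mem_bilinearSum (hμ : IsMeasureOn S μ) (hA : A ∈ S)
    (hL_right : ∀ v : V, Continuous fun w : W => L v w)
    (hL_left : ∀ w : W, Continuous fun v : V => L v w) {C : Set (V × X)} (hC : IsPointed C)
    {κ : Type} {J : Finset κ} {E : κ → Set X} {c : κ → V} (hE : ∀ j ∈ J, E j ∈ localAlgebra S A)
    (hd : (J : Set κ).PairwiseDisjoint E)
    (hc : ∀ j ∈ J, c j ∈ closure (commonFibre C (E j))) :
    ∑ j ∈ J, L (c j) (extend S μ (E j)) ∈ bilinearSum L S μ C := by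
  classical
  have hclosed : IsClosed (bilinearSum L S μ C) := isClosed_closure
  refine finsetSum_mem_of_forall_mem_closure hclosed
    (U := fun j => (fun v => L v (extend S μ (E j))) '' commonFibre C (E j)) ?_
    fun j hj => map_mem_closure (f := fun v => L v (extend S μ (E j))) (hL_left _)
      (hc j hj) fun v hv => mem_image_of_mem _ hv
  intro z hz
  choose! v hv hvz using hz
  have hdec : ∀ j, ∃ (ι : Type) (P : ι → Set X), j ∈ J → Countable ι ∧
      IsDecomposition S (E j) P := fun j => by
    by_cases hj : j ∈ J
    · obtain ⟨ι, hι, P, hP⟩ := (hE j hj).2.1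
      exact ⟨ι, P, fun _ => ⟨hι, hP⟩⟩
    · exact ⟨Empty, fun i => i.elim, fun h => absurd h hj⟩
  choose ι P hP using hdec
  refine finsetSum_mem_of_forall_mem_closure hclosed
    (U := fun j => {z | ∃ F : Finset (ι j), ∑ i ∈ F, L (v j) (μ (P j i)) = z}) ?_ fun j hj => ?_
  · intro z hz
    choose! F hF using hz
    refine subset_closure ⟨Σ j : J, F j, inferInstance, fun p => v p.1, fun p => P p.1 p.2,
      fun p => (hP p.1 p.1.2).2.mem p.2, fun x => ?_, ?_⟩
    · have hPE : ∀ p : Σ j : J, F j, P p.1 p.2 ⊆ E p.1 := fun p => by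
        rw [← (hP p.1 p.1.2).2.iUnion_eq]
        exact subset_iUnion _ _
      by_cases hx : ∃ p : Σ j : J, F j, x ∈ P p.1 p.2
      · obtain ⟨p, hp⟩ := hx
        rw [stepFun, Finset.sum_eq_single p]
        · rw [indicator_of_mem hp]
          exact mem_iInter₂.1 (hv p.1 p.1.2) x (hPE p hp)
        · rintro ⟨j, i⟩ - hne
          refine indicator_of_notMem (fun hx => hne ?_) _
          obtain ⟨k, l⟩ := p
          have hjk : j = k := by
            by_contra h
            exact disjoint_left.1 (hd j.2 k.2 fun h' => h (Subtype.ext h')) (hPE ⟨j, i⟩ hx)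
              (hPE ⟨k, l⟩ hp)
          subst hjk
          have hil : i = l := by
            by_contra h
            exact disjoint_left.1 ((hP j j.2).2.disjoint fun h' => h (Subtype.ext h')) hx hp
          rw [hil]
        · exact fun h => absurd (Finset.mem_univ p) h
      · rw [stepFun, Finset.sum_eq_zero]
        · exact hC x
        · exact fun p _ => indicator_of_notMem (fun h => hx ⟨p, h⟩) _
    · rw [Fintype.sum_sigma, ← Finset.sum_coe_sort J]
      refine Finset.sum_congr rfl fun j _ => ?_
      rw [← hF j j.2, ← Finset.sum_coe_sort (F j)]
  · have := (hP j hj).1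
    rw [← hvz j hj]
    exact mem_closure_of_tendsto ((hμ.hasSum_extend hA (hE j hj) (hP j hj).2).map (L (v j))
      (hL_right _)) (Eventually.of_forall fun F => ⟨F, rfl⟩)

theorem IsSigmaLocallyFiniteSemivariation.exists_isSmallCover
    (h : IsSigmaLocallyFiniteSemivariation L S μ) (hS : IsIntervalSystem S)
    (hμ : IsMeasureOn S μ) (hA : A ∈ S) [T1Space V]
    (hL_right : ∀ v : V, Continuous fun w : W => L v w)
    (hL_left : ∀ w : W, Continuous fun v : V => L v w) {T : Set Z} (hT : T ∈ 𝓝 0) :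
    ∃ D K, IsSmallCover L (localAlgebra S A) A (extend S μ) T D K := by
  obtain ⟨T₀, hT₀, hT₀c, hT₀T⟩ := exists_mem_nhds_isClosed_subset hT
  obtain ⟨T₁, hT₁, hT₁T₀⟩ := exists_nhds_half_neg hT₀
  obtain ⟨C, hCenv, hC, hCT, hint⟩ := h A hA T₁ hT₁
  obtain ⟨𝔇, h𝔇S, h𝔇, hgen⟩ := hCenv.exists_generator
  -- The extra pair `(A, {0})` serves the points outside `⋃₀ 𝔇`, where the fibre of `C` is `{0}`,
  -- and makes the family nonempty so that a sequence enumerates it.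
  obtain ⟨f, hf⟩ := ((h𝔇.image fun D => (D ∩ A, closure (commonFibre C D))).insert
    (A, {(0 : V)})).exists_eq_range (insert_nonempty _ _)
  have hcases : ∀ n, f n = (A, {(0 : V)}) ∨
      ∃ D ∈ 𝔇, f n = (D ∩ A, closure (commonFibre C D)) := fun n => by
    have : f n ∈ range f := mem_range_self n
    rw [← hf] at this
    rcases this with h | ⟨D, hD, h⟩
    exacts [Or.inl h, Or.inr ⟨D, hD, h.symm⟩]
  have hzero : ∀ D, (0 : V) ∈ commonFibre C D := fun D => mem_iInter₂.2 fun x _ => hC x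
  have hKsub : ∀ n E, E ⊆ (f n).1 → (f n).2 ⊆ closure (commonFibre C E) := by
    intro n E hE
    rcases hcases n with h | ⟨D, hD, h⟩
    · rw [h]
      rintro _ rfl
      exact subset_closure (hzero E)
    · rw [h] at hE ⊢
      exact closure_mono (biInter_mono (hE.trans inter_subset_left) fun _ _ => Subset.rfl)
  refine ⟨fun n => (f n).1, fun n => (f n).2, fun n => ?_, fun n => ?_, fun n => ?_,
    fun x hx => ?_, fun κ J E n c hE hd hED hc => ?_⟩
  · rcases hcases n with h | ⟨D, hD, h⟩ <;> rw [h]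
    · exact mem_localAlgebra hS hA hA Subset.rfl
    · exact inter_mem_localAlgebra hS hA (h𝔇S hD)
  · rcases hcases n with h | ⟨D, hD, h⟩ <;> rw [h]
    · exact isClosed_singleton
    · exact isClosed_closure
  · rcases hcases n with h | ⟨D, hD, h⟩ <;> rw [h]
    · exact mem_singleton _
    · exact subset_closure (hzero D)
  · refine ⟨_, mem_interior_iff_mem_nhds.1 (hint x hx), fun v hv => ?_⟩
    have hv' : (v, x) ∈ generatedBy C 𝔇 := hgen ▸ hv
    rcases hv' with hv' | hv'
    · obtain ⟨D, hD, hvD, hxD⟩ := mem_iUnion₂.1 hv'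
      have : (D ∩ A, closure (commonFibre C D)) ∈ range f :=
        hf ▸ mem_insert_of_mem _ (mem_image_of_mem _ hD)
      obtain ⟨n, hn⟩ := this
      refine mem_iUnion₂.2 ⟨n, ?_, ?_⟩
      · change x ∈ (f n).1
        rw [hn]; exact ⟨hxD, hx⟩
      · rw [hn]; exact subset_closure hvD
    · have : (A, {(0 : V)}) ∈ range f := hf ▸ mem_insert _ _
      obtain ⟨n, hn⟩ := this
      refine mem_iUnion₂.2 ⟨n, ?_, ?_⟩
      · change x ∈ (f n).1
        rw [hn]; exact hx
      · rw [hn]; exact hv'.1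
  · refine hT₀T (finsetSum_mem_of_forall_mem_closure hT₀c
      (U := fun j => (fun v => L v (extend S μ (E j))) '' ((f (n j)).2 - (f (n j)).2)) ?_
      fun j hj => map_mem_closure (f := fun v => L v (extend S μ (E j))) (hL_left _)
      (hc j hj) fun v hv => mem_image_of_mem _ hv)
    intro z hz
    have hz' : ∀ j ∈ J, ∃ v ∈ (f (n j)).2, ∃ w ∈ (f (n j)).2,
        L v (extend S μ (E j)) - L w (extend S μ (E j)) = z j := by
      intro j hj
      obtain ⟨_, ⟨v, hv, w, hw, rfl⟩, h⟩ := hz j hj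
      exact ⟨v, hv, w, hw, by rw [← h]; simp⟩
    choose! v hv w hw hvw using hz'
    rw [← Finset.sum_congr rfl hvw, Finset.sum_sub_distrib]
    exact hT₁T₀ _ (hCT (sum_mem_bilinearSum hμ hA hL_right hL_left hC hE hd
      fun j hj => hKsub _ _ (hED j hj) (hv j hj))) _
      (hCT (sum_mem_bilinearSum hμ hA hL_right hL_left hC hE hd
        fun j hj => hKsub _ _ (hED j hj) (hw j hj)))

end semivariation

/-! ### The product system and its measure -/

theorem IsDecomposable.exists_sUnion {X : Type*} {S : Set (Set X)} {E : Set X}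
    (h : IsDecomposable S E) :
    ∃ C : Set (Set X), C ⊆ S ∧ C.Countable ∧ C.PairwiseDisjoint id ∧ ⋃₀ C = E := by
  obtain ⟨ι, _, P, hP⟩ := h
  refine ⟨range P, range_subset_iff.2 hP.mem, countable_range P, ?_, ?_⟩
  · rintro _ ⟨i, rfl⟩ _ ⟨j, rfl⟩ hne
    exact hP.disjoint fun h => hne (by rw [h])
  · rw [sUnion_range, hP.iUnion_eq]

theorem IsDecomposition.prod {X Y ι κ : Type*} {R : Set (Set Y)} {S : Set (Set X)}
    {𝓔 : Set (Set (Y × X))} {B : Set Y} {A : Set X} {P : ι → Set Y} {Q : κ → Set X}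
    (hP : IsDecomposition R B P) (hQ : IsDecomposition S A Q) (h𝓔 : ∀ i k, P i ×ˢ Q k ∈ 𝓔) :
    IsDecomposition 𝓔 (B ×ˢ A) fun p : ι × κ => P p.1 ×ˢ Q p.2 := by
  refine ⟨fun p => h𝓔 p.1 p.2, ?_, ?_⟩
  · rintro ⟨i, k⟩ ⟨j, l⟩ hne
    by_cases h : i = j
    · subst h
      exact Disjoint.set_prod_right (hQ.disjoint fun h : k = l => hne (by rw [h])) _ _
    · exact Disjoint.set_prod_left (hP.disjoint h) _ _
  · rw [← hP.iUnion_eq, ← hQ.iUnion_eq]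
    ext ⟨y, x⟩
    simp only [mem_iUnion, mem_prod, Prod.exists, exists_and_left, exists_and_right]

section product

variable {X Y V W Z : Type*} [AddCommGroup V] [AddCommGroup W] [AddCommGroup Z]
  {L : V →+ W →+ Z} {R : Set (Set Y)} {S : Set (Set X)} {ν : Set Y → V} {μ : Set X → W}

/-- Decompositions of the smaller sides extend to `B` and `A` by decomposing the differences, and a
subfamily of a summable family is summable in a complete group. -/
theorem prod_mem_prodSystem_of_subset [UniformSpace Z] [IsUniformAddGroup Z] [CompleteSpace Z]
    (hR : IsIntervalSystem R) (hS : IsIntervalSystem S) {B B' : Set Y} {A A' : Set X}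
    (hB : B ∈ R) (hA : A ∈ S) (hB' : B' ∈ R) (hA' : A' ∈ S) (hBB : B' ⊆ B) (hAA : A' ⊆ A)
    (hsum : ∀ (Γ Λ : Type) [Countable Γ] [Countable Λ] (P : Γ → Set Y) (Q : Λ → Set X),
      IsDecomposition R B P → IsDecomposition S A Q →
        Summable fun p : Γ × Λ => L (ν (P p.1)) (μ (Q p.2))) :
    B' ×ˢ A' ∈ prodSystem L R S ν μ := by
  refine ⟨B', hB', A', hA', rfl, fun Γ Λ _ _ P Q hP hQ => ?_⟩
  obtain ⟨Γ', _, P', hP'⟩ := hR.isDecomposable_diff hB hB'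
  obtain ⟨Λ', _, Q', hQ'⟩ := hS.isDecomposable_diff hA hA'
  have h := hsum (Γ ⊕ Γ') (Λ ⊕ Λ') _ _ (hP.sumElim hP' hBB) (hQ.sumElim hQ' hAA)
  exact h.comp_injective (i := Prod.map Sum.inl Sum.inl)
    (Sum.inl_injective.prodMap Sum.inl_injective)

theorem isIntervalSystem_prodSystem [UniformSpace Z] [IsUniformAddGroup Z] [CompleteSpace Z]
    (hR : IsIntervalSystem R) (hS : IsIntervalSystem S) :
    IsIntervalSystem (prodSystem L R S ν μ) := by
  rintro _ ⟨B, hB, A, hA, rfl, hsum⟩ _ ⟨B', hB', A', hA', rfl, -⟩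
  have key : ∀ F G, F ⊆ B → G ⊆ A → IsDecomposable R F → IsDecomposable S G →
      IsDecomposable (prodSystem L R S ν μ) (F ×ˢ G) := by
    rintro F G hF hG ⟨ι, _, P, hP⟩ ⟨κ, _, Q, hQ⟩
    refine ⟨ι × κ, inferInstance, _, hP.prod hQ fun i k =>
      prod_mem_prodSystem_of_subset hR hS hB hA (hP.mem i) (hQ.mem k) ?_ ?_ hsum⟩
    · exact (hP.iUnion_eq ▸ subset_iUnion P i : P i ⊆ F).trans hF
    · exact (hQ.iUnion_eq ▸ subset_iUnion Q k : Q k ⊆ G).trans hG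
  refine ⟨IsDecomposable.exists_sUnion ?_, IsDecomposable.exists_sUnion ?_⟩
  · have : B ×ˢ A \ B' ×ˢ A' = (B \ B') ×ˢ A ∪ (B ∩ B') ×ˢ (A \ A') := by
      ext ⟨y, x⟩
      simp only [Set.mem_sdiff, mem_prod, mem_union, mem_inter_iff]
      tauto
    rw [this]
    refine (key _ _ sdiff_subset Subset.rfl (hR.isDecomposable_diff hB hB') (.of_mem hA)).union
      (key _ _ inter_subset_left sdiff_subset (hR.isDecomposable_inter_of_mem hB hB')
        (hS.isDecomposable_diff hA hA')) ?_
    exact Disjoint.set_prod_left (disjoint_sdiff_left.mono_right inter_subset_right) _ _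
  · rw [prod_inter_prod]
    exact key _ _ inter_subset_left inter_subset_left (hR.isDecomposable_inter_of_mem hB hB')
      (hS.isDecomposable_inter_of_mem hA hA')

/-- A nonempty rectangle determines its sides; in an empty one some side is empty and has measure
zero. -/
theorem eq_of_prod_eq_prod [TopologicalSpace V] [T2Space V] [TopologicalSpace W] [T2Space W]
    (hν : IsMeasureOn R ν) (hμ : IsMeasureOn S μ) {B B' : Set Y} {A A' : Set X} (hB : B ∈ R)
    (hA : A ∈ S) (hB' : B' ∈ R) (hA' : A' ∈ S) (h : B ×ˢ A = B' ×ˢ A') :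
    L (ν B) (μ A) = L (ν B') (μ A') := by
  have hzero : ∀ {B : Set Y} {A : Set X}, B ∈ R → A ∈ S → B ×ˢ A = ∅ → L (ν B) (μ A) = 0 := by
    intro B A hB hA h
    rcases prod_eq_empty_iff.1 h with rfl | rfl
    · rw [hν.empty hB, map_zero, AddMonoidHom.zero_apply]
    · rw [hμ.empty hA, map_zero]
  rcases (B ×ˢ A).eq_empty_or_nonempty with h0 | hne
  · rw [hzero hB hA h0, hzero hB' hA' (h ▸ h0)]
  · obtain ⟨rfl, rfl⟩ := (prod_eq_prod_iff_of_nonempty hne).1 h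
    rfl

theorem exists_eq_on_prod [TopologicalSpace V] [T2Space V] [TopologicalSpace W] [T2Space W]
    (hν : IsMeasureOn R ν) (hμ : IsMeasureOn S μ) :
    ∃ ρ : Set (Y × X) → Z, ∀ B ∈ R, ∀ A ∈ S, ρ (B ×ˢ A) = L (ν B) (μ A) := by
  classical
  refine ⟨fun E => if h : ∃ B ∈ R, ∃ A ∈ S, B ×ˢ A = E then
    L (ν h.choose) (μ h.choose_spec.2.choose) else 0, fun B hB A hA => ?_⟩
  have h : ∃ B' ∈ R, ∃ A' ∈ S, B' ×ˢ A' = B ×ˢ A := ⟨B, hB, A, hA, rfl⟩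
  dsimp only
  rw [dif_pos h]
  exact eq_of_prod_eq_prod hν hμ h.choose_spec.1 h.choose_spec.2.choose_spec.1 hB hA
    h.choose_spec.2.choose_spec.2

/-- Decomposing each piece further within `R` and `S` gives a summable grid. Grouping it into
blocks, each block sums to the value at the original pair by separate continuity, one variable at a
time. -/
theorem summable_extend [UniformSpace V] [IsUniformAddGroup V] [CompleteSpace V] [T2Space V]
    [UniformSpace W] [IsUniformAddGroup W] [CompleteSpace W] [T2Space W] [UniformSpace Z]
    [IsUniformAddGroup Z] [CompleteSpace Z] [T2Space Z]
    (hL_right : ∀ v : V, Continuous fun w : W => L v w)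
    (hL_left : ∀ w : W, Continuous fun v : V => L v w)
    (hν : IsMeasureOn R ν) (hμ : IsMeasureOn S μ) {B : Set Y} {A : Set X} (hB : B ∈ R)
    (hA : A ∈ S)
    (hsum : ∀ (Γ Λ : Type) [Countable Γ] [Countable Λ] (P : Γ → Set Y) (Q : Λ → Set X),
      IsDecomposition R B P → IsDecomposition S A Q →
        Summable fun p : Γ × Λ => L (ν (P p.1)) (μ (Q p.2)))
    {Γ Λ : Type} [Countable Γ] [Countable Λ] {P : Γ → Set Y} {Q : Λ → Set X}
    (hP : IsDecomposition (localAlgebra R B) B P) (hQ : IsDecomposition (localAlgebra S A) A Q) :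
    Summable fun p : Γ × Λ => L (extend R ν (P p.1)) (extend S μ (Q p.2)) := by
  choose ι hι P' hP' using fun γ => (hP.mem γ).2.1
  choose κ hκ Q' hQ' using fun l => (hQ.mem l).2.1
  let g : (Σ p : Γ × Λ, ι p.1 × κ p.2) → (Σ γ, ι γ) × (Σ l, κ l) :=
    fun q => (⟨q.1.1, q.2.1⟩, ⟨q.1.2, q.2.2⟩)
  have hg : Function.Injective g := by
    rintro ⟨⟨γ, l⟩, i, k⟩ ⟨⟨γ', l'⟩, i', k'⟩ h
    simp only [g, Prod.mk.injEq, Sigma.mk.injEq] at h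
    obtain ⟨⟨rfl, hi⟩, rfl, hk⟩ := h
    rw [eq_of_heq hi, eq_of_heq hk]
  have h1 := (hsum _ _ _ _ (hP.sigma hP') (hQ.sigma hQ')).comp_injective hg
  refine h1.sigma.congr fun p => ?_
  have h2 := (h1.sigma_factor p).hasSum.prod_fiberwise (g := fun i =>
    L (ν (P' p.1 i)) (extend S μ (Q p.2))) fun i =>
      (hμ.hasSum_extend hA (hQ.mem p.2) (hQ' p.2)).map (L (ν (P' p.1 i))) (hL_right _)
  exact h2.unique ((hν.hasSum_extend hB (hP.mem p.1) (hP' p.1)).map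
    (L.flip (extend S μ (Q p.2))) (hL_left _))

theorem isMeasureOn_prodSystem [UniformSpace V] [IsUniformAddGroup V] [CompleteSpace V] [T2Space V]
    [UniformSpace W] [IsUniformAddGroup W] [CompleteSpace W] [T2Space W] [UniformSpace Z]
    [IsUniformAddGroup Z] [CompleteSpace Z] [T2Space Z]
    (hR : IsIntervalSystem R) (hS : IsIntervalSystem S)
    (hν : IsMeasureOn R ν) (hμ : IsMeasureOn S μ)
    (hL_right : ∀ v : V, Continuous fun w : W => L v w)
    (hL_left : ∀ w : W, Continuous fun v : V => L v w)
    (hν_fin : IsSigmaLocallyFiniteSemivariation L.flip R ν)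
    (hμ_fin : IsSigmaLocallyFiniteSemivariation L S μ) {ρ : Set (Y × X) → Z}
    (hρ : ∀ B ∈ R, ∀ A ∈ S, ρ (B ×ˢ A) = L (ν B) (μ A)) :
    IsMeasureOn (prodSystem L R S ν μ) ρ := by
  classical
  rintro _ ⟨B, hB, A, hA, rfl, hsum⟩ ι _ P hP
  choose b hb a ha hPba _ using hP.mem
  -- An empty rectangle may have a nonempty side that is not contained in `B` or `A`; replacing both
  -- sides by `∅` keeps them in the local algebras.
  let b' : ι → Set Y := fun i => if (P i).Nonempty then b i else ∅
  let a' : ι → Set X := fun i => if (P i).Nonempty then a i else ∅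
  have hPb' : ∀ i, P i = b' i ×ˢ a' i := fun i => by
    by_cases h : (P i).Nonempty
    · simp only [b', a', if_pos h, hPba i]
    · simp only [b', a', if_neg h, not_nonempty_iff_eq_empty.1 h, empty_prod]
  have hsub : ∀ i, (P i).Nonempty → b i ⊆ B ∧ a i ⊆ A := fun i hi => by
    have h1 : P i ⊆ B ×ˢ A := hP.iUnion_eq ▸ subset_iUnion P i
    rw [hPba i] at h1 hi
    exact (prod_subset_prod_iff.1 h1).resolve_right fun h => by
      rw [← prod_eq_empty_iff] at h
      exact hi.ne_empty h
  have h𝓡 := isAlgebraOn_localAlgebra hR hB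
  have h𝒜 := isAlgebraOn_localAlgebra hS hA
  have hνB := hν.isMeasureOn_extend hB
  have hμA := hμ.isMeasureOn_extend hA
  have hval : ∀ i, ρ (P i) = L (extend R ν (b' i)) (extend S μ (a' i)) := fun i => by
    by_cases h : (P i).Nonempty
    · simp only [b', a', if_pos h]
      rw [hν.extend_eq hR hB (hb i) (hsub i h).1, hμ.extend_eq hS hA (ha i) (hsub i h).2,
        ← hρ _ (hb i) _ (ha i), ← hPba i]
    · simp only [b', a', if_neg h, hμA.empty h𝒜.empty_mem, map_zero]
      rw [hPba i, hρ _ (hb i) _ (ha i)]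
      rw [hPba i, not_nonempty_iff_eq_empty] at h
      rcases prod_eq_empty_iff.1 h with h0 | h0
      · rw [h0, hν.empty (h0 ▸ hb i), map_zero, AddMonoidHom.zero_apply]
      · rw [h0, hμ.empty (h0 ▸ ha i), map_zero]
  rw [hρ B hB A hA, ← hν.extend_eq hR hB hB Subset.rfl, ← hμ.extend_eq hS hA hA Subset.rfl]
  simp only [hval]
  refine hasSum_of_grid h𝓡 h𝒜 hνB hμA hL_right hL_left
    (fun T hT => hν_fin.exists_isSmallCover hR hν hB hL_left hL_right hT)
    (fun T hT => hμ_fin.exists_isSmallCover hS hμ hA hL_right hL_left hT)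
    (fun Γ Λ _ _ P Q hP hQ => summable_extend hL_right hL_left hν hμ hB hA hsum hP hQ)
    (fun i => ?_) (fun i => ?_) (fun i j hij => ?_) ?_
  · simp only [b']
    split_ifs with h
    exacts [mem_localAlgebra hR hB (hb i) (hsub i h).1, h𝓡.empty_mem]
  · simp only [a']
    split_ifs with h
    exacts [mem_localAlgebra hS hA (ha i) (hsub i h).2, h𝒜.empty_mem]
  · have : Disjoint (P i) (P j) := hP.disjoint hij
    rwa [hPb' i, hPb' j] at this
  · rw [← hP.iUnion_eq]
    exact iUnion_congr fun i => (hPb' i).symm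

end product

end IntervalIntegration

theorem mainTheorem8 {X Y V W Z : Type*}
    [AddCommGroup V] [UniformSpace V] [IsUniformAddGroup V] [CompleteSpace V] [T2Space V]
    [AddCommGroup W] [UniformSpace W] [IsUniformAddGroup W] [CompleteSpace W] [T2Space W]
    [AddCommGroup Z] [UniformSpace Z] [IsUniformAddGroup Z] [CompleteSpace Z] [T2Space Z]
    (R : Set (Set Y)) (S : Set (Set X))
    (hR : IntervalIntegration.IsIntervalSystem R) (hS : IntervalIntegration.IsIntervalSystem S)
    (ν : Set Y → V) (μ : Set X → W)
    (hν : IntervalIntegration.IsMeasureOn R ν) (hμ : IntervalIntegration.IsMeasureOn S μ)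
    (L : V →+ W →+ Z)
    (hL_right : ∀ v : V, Continuous fun w : W => L v w)
    (hL_left : ∀ w : W, Continuous fun v : V => L v w)
    (hν_fin : IntervalIntegration.IsSigmaLocallyFiniteSemivariation L.flip R ν)
    (hμ_fin : IntervalIntegration.IsSigmaLocallyFiniteSemivariation L S μ) :
    IntervalIntegration.IsIntervalSystem (IntervalIntegration.prodSystem L R S ν μ) ∧
    ∃ ρ : Set (Y × X) → Z,
      (∀ B ∈ R, ∀ A ∈ S, B ×ˢ A ∈ IntervalIntegration.prodSystem L R S ν μ →
        ρ (B ×ˢ A) = L (ν B) (μ A)) ∧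
      IntervalIntegration.IsMeasureOn (IntervalIntegration.prodSystem L R S ν μ) ρ := by
  obtain ⟨ρ, hρ⟩ := IntervalIntegration.exists_eq_on_prod (L := L) hν hμ
  exact ⟨IntervalIntegration.isIntervalSystem_prodSystem hR hS, ρ, fun B hB A hA _ => hρ B hB A hA,
    IntervalIntegration.isMeasureOn_prodSystem hR hS hν hμ hL_right hL_left hν_fin hμ_fin hρ⟩
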